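/- **Setting.** Let $n,L,q\ge 1$ and $p\ge 3$ be integers, let $\mathbf X\in[-1,1]^{n\times p}$ have exactly $q$ non-zero entries in each row, and put $\delta=q/p$. Let $\boldsymbol\theta\in\mathbb R^p$, let $\boldsymbol\Theta\in\mathbb R^{p\times p}$ have zero diagonal, and define $$f^*_i=\sum_{k}X_{ik}\theta_k+\sum_{k,k_1}X_{ik}\mathbb 1_{\{X_{ik_1}=0\}}\Theta_{kk_1},\qquad \ell=\|\boldsymbol\theta\|_2+\Big(2(2-q/p)\,q\sum_{k,k_1,k_2}|\Theta_{kk_1}\Theta_{kk_2}|\Big)^{1/2}.$$ We observe $\mathbf Y=\alpha^*\mathbf 1+\mathbf f^*+\boldsymbol\gamma+\boldsymbol\varepsilon$, where $\alpha^*\in\mathbb R$, $\boldsymbol\gamma\in\mathbb R^n$ is deterministic with $\boldsymbol\gamma^T\mathbf 1=0$, and $\mathbb E\varepsilon_i=0$, $\mathbb E\varepsilon_i^2=\sigma^2$ with $\sigma>0$, $\mathrm{Cov}(\varepsilon_i,\varepsilon_j)=0$ for $i\ne j$. *Random-sign min-wise hashing.* Let $\pi_1,\dots,\pi_L$ be i.i.d.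 uniform permutations of $\{1,\dots,p\}$ and $\boldsymbol\Psi\in\{-1,1\}^{p\times L}$ a matrix of i.i.d. fair signs, with $\boldsymbol\pi,\boldsymbol\Psi,\boldsymbol\varepsilon$ independent. Let $H_{il}$ be the minimiser of $\pi_l(k)$ over $\{k:X_{ik}\neq0\}$, and let $\mathbf S\in\mathbb R^{n\times L}$ be given by $S_{il}=\Psi_{H_{il}l}X_{iH_{il}}$. *Estimator.* For $\eta>0$ let $(\hat\alpha,\hat{\mathbf b}^\eta)$ minimise $\|\mathbf Y-\alpha\mathbf 1-\mathbf S\mathbf b\|_2^2$ over $(\alpha,\mathbf b)\in\mathbb R\times\mathbb R^L$ subject to $\|\mathbf b\|_2^2\le(1+\eta)\,2(2-q/p)\,q\,\ell^2/L$, and let $$\mathrm{MSPE}=\frac1n\,\mathbb E_{\boldsymbol\varepsilon,\boldsymbol\pi,\boldsymbol\Psi}\big\|\alpha^*\mathbf 1+\mathbf f^*-\hat\alpha\mathbf 1-\mathbf S\hat{\mathbf b}^\eta\big\|_2^2 .$$ **Theorem.** Let $L^*=\sqrt{(2-q/p)qn}\,\ell/\sigma$, $\bar f^*=\frac1n\sum_i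 f^*_i$ and $$\rho_2=\exp\Big(-\frac{L\eta^2}{2(2-\delta)(3+2\eta)q}\Big)+\exp\Big(-\frac{L\eta^2}{4(2-\delta)^2(3+2\eta)q^2}\Big).$$ Then the expectation defining the MSPE is finite and $$\mathrm{MSPE}\le\sqrt{(2-q/p)q}\;\ell\;\frac{2\sigma\sqrt{1+\eta}+\sqrt2\,\sigma\,(L^*/L)}{\sqrt n}+\rho_2\,\frac{\|\mathbf f^*-\bar f^*\mathbf 1+\boldsymbol\gamma\|_2^2}{n}+\frac{\|\boldsymbol\gamma\|_2^2}{n}+\frac{\sigma^2}{n}.$$ -/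

import Mathlib

open MeasureTheory ProbabilityTheory
open scoped Matrix

namespace MinWise

noncomputable section

/-- The squared Euclidean norm of a vector. -/
def sqNorm {m : ℕ} (v : Fin m → ℝ) : ℝ := ∑ i, v i ^ 2

/-- The average of the components of a vector. -/
def mean {m : ℕ} (v : Fin m → ℝ) : ℝ := (∑ i, v i) / m

/-- The set `z_i` of the variables with a non-zero entry in row `i`. -/
def rowSupport {n p : ℕ} (X : Matrix (Fin n) (Fin p) ℝ) (i : Fin n) : Finset (Fin p) :=
  {k | X i k ≠ 0}

/-- The randomness of random-sign min-wise hashing: one permutation of the `p` variables for each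
of the `L` columns (`perm l k` is the position of variable `k`), and a `p × L` matrix of signs. -/
@[ext] structure HashSeed (p L : ℕ) where
  perm : Fin L → Equiv.Perm (Fin p)
  sign : Fin p → Fin L → ℤˣ

/-- There are finitely many seeds; every set of seeds is an event. -/
instance (p L : ℕ) : MeasurableSpace (HashSeed p L) := ⊤

instance (p L : ℕ) : DiscreteMeasurableSpace (HashSeed p L) := ⟨fun _ => trivial⟩

instance (p L : ℕ) : Finite (HashSeed p L) :=
  Finite.of_injective (fun s => (s.perm, s.sign)) fun s t h => by
    simp only [Prod.mk.injEq] at h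
    exact HashSeed.ext h.1 h.2

instance (p L : ℕ) : Nonempty (HashSeed p L) := ⟨⟨fun _ => 1, fun _ _ => 1⟩⟩

/-- The law of the seed: uniform on all pairs (permutations, signs). Equivalently, the permutations
are i.i.d. uniform, the signs are i.i.d. fair, and permutations and signs are independent. -/
def hashLaw (p L : ℕ) : Measure (HashSeed p L) := uniformOn Set.univ

instance (p L : ℕ) : IsProbabilityMeasure (hashLaw p L) :=
  isProbabilityMeasure_uniformOn Set.finite_univ Set.univ_nonempty

/-- The variable `H = argmin_{k ∈ z} π(k)`, i.e. `π⁻¹ (min_{k ∈ z} π(k))`. -/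
def minHash {p : ℕ} (z : Finset (Fin p)) (hz : z.Nonempty) (π : Equiv.Perm (Fin p)) : Fin p :=
  π.symm ((z.image π).min' (hz.image π))

/-- The matrix `S` of random-sign min-wise hashing, `S_{il} = Ψ_{H_{il} l} X_{i H_{il}}`
(and `0` when the row `i` of `X` vanishes). -/
def hashMatrix {n p L : ℕ} (X : Matrix (Fin n) (Fin p) ℝ) (s : HashSeed p L) :
    Matrix (Fin n) (Fin L) ℝ :=
  Matrix.of fun i l =>
    if h : (rowSupport X i).Nonempty then
      ((s.sign (minHash (rowSupport X i) h (s.perm l)) l : ℤ) : ℝ) *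
        X i (minHash (rowSupport X i) h (s.perm l))
    else 0

/-- The interaction signal
`f*_i = ∑_k X_{ik} θ_k + ∑_{k,k₁} X_{ik} 1{X_{ik₁} = 0} Θ_{k k₁}`. -/
def interactionSignal {n p : ℕ} (X : Matrix (Fin n) (Fin p) ℝ) (θ : Fin p → ℝ)
    (Θ : Matrix (Fin p) (Fin p) ℝ) (i : Fin n) : ℝ :=
  ∑ k, X i k * θ k + ∑ k, ∑ k₁, X i k * (if X i k₁ = 0 then 1 else 0) * Θ k k₁

/-- The size of the coefficients,
`ℓ(Θ*) = ‖θ‖₂ + (2 (2 - q/p) q ∑_{k,k₁,k₂} |Θ_{k k₁} Θ_{k k₂}|)^{1/2}`. -/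
def coefSize {p : ℕ} (q : ℕ) (θ : Fin p → ℝ) (Θ : Matrix (Fin p) (Fin p) ℝ) : ℝ :=
  √(sqNorm θ) + √(2 * (2 - (q : ℝ) / p) * q * ∑ k, ∑ k₁, ∑ k₂, |Θ k k₁ * Θ k k₂|)

/-- `(a, b)` minimises `‖Y - a 1 - S b‖₂²` over `ℝ × ℝ^L` subject to `‖b‖₂² ≤ r`. -/
def IsConstrainedRidge {n L : ℕ} (Y : Fin n → ℝ) (S : Matrix (Fin n) (Fin L) ℝ) (r : ℝ)
    (a : ℝ) (b : Fin L → ℝ) : Prop :=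
  sqNorm b ≤ r ∧ ∀ (a' : ℝ) (b' : Fin L → ℝ), sqNorm b' ≤ r →
    sqNorm (fun i => Y i - a - (S *ᵥ b) i) ≤ sqNorm (fun i => Y i - a' - (S *ᵥ b') i)

/-- The loss `‖α* 1 + f - a 1 - S b‖₂²`. -/
def fitLoss {n L : ℕ} (αs : ℝ) (f : Fin n → ℝ) (S : Matrix (Fin n) (Fin L) ℝ)
    (a : ℝ) (b : Fin L → ℝ) : ℝ :=
  sqNorm fun i => αs + f i - a - (S *ᵥ b) i

/-- The mean-squared prediction error `E ‖α* 1 + f - α̂ 1 - S b̂‖₂² / n`. -/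
def mspe {n L : ℕ} {Ω : Type*} [MeasurableSpace Ω] (P : Measure Ω) (αs : ℝ) (f : Fin n → ℝ)
    (S : Ω → Matrix (Fin n) (Fin L) ℝ) (a : Ω → ℝ) (b : Ω → Fin L → ℝ) : ℝ :=
  (∫ ω, fitLoss αs f (S ω) (a ω) (b ω) ∂P) / n

/-- The squared radius `(1 + η) · 2 (2 - q/p) q ℓ² / L` of the ridge constraint. -/
def ridgeRadius (p q L : ℕ) (η l : ℝ) : ℝ :=
  (1 + η) * (2 * (2 - (q : ℝ) / p) * q * l ^ 2 / L)

/-- `L* = √((2 - q/p) q n) ℓ / σ`. -/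
def optDim (n p q : ℕ) (σ l : ℝ) : ℝ := √((2 - (q : ℝ) / p) * q * n) * l / σ

/-- `ρ₂`, with `δ = q/p`. -/
def rhoTwo (p q L : ℕ) (η : ℝ) : ℝ :=
  Real.exp (-(L * η ^ 2 / (2 * (2 - (q : ℝ) / p) * (3 + 2 * η) * q))) +
    Real.exp (-(L * η ^ 2 / (4 * (2 - (q : ℝ) / p) ^ 2 * (3 + 2 * η) * (q : ℝ) ^ 2)))

end

end MinWise

/-!
The loss splits into the error of the centred fit `Q S b̂` and the error of the intercept, where
`Q` subtracts the mean; the latter contributes `σ²` exactly. The centred fit is the least squares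
fit over a ball of radius `√r`, and it is compared with an explicit oracle vector `b*` of
coefficients for the hashed columns. Averaging over seed and noise, which are independent, gives
the bound.

*Risk for a fixed seed* (`integral_sq_dist_constrained_le`). Let `b` minimise `‖f + γ + ε - A b‖`
over the unit ball, and let `H` be the Lagrange multiplier, so that `A†` maps the residual to
`H b`. Taking means in this stationarity condition, `Λ = E (H b)` is `A†` of the mean residual `v`,
and Cauchy–Schwarz bounds both `E ⟪A† ε, b - E b⟫` and `E (H ⟪v, A (b - E b)⟫)`. These two bounds,
through the scalar inequality `tradeoff`, give a risk of at most
`‖γ‖² + 7/5 ‖A β - f‖² + N (1 + 4/5 ‖β‖²)` for every `β` in the ball, where `N² ≥ E ‖A† ε‖²`, and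
an extra term `1/2 (‖β‖ - 1) ‖f + γ‖²` for `β` outside it. Only second moments of the noise enter.
The constants matter: `‖β‖²` has mean at most `1/2` below, and `7/5 ≤ √2`.

*The oracle.* Variable `k` at position `j = π k` is the first of `q` active variables with a
hypergeometric probability `hashProb p q j`. Weighting main effects proportionally to it
(`mainWeight`), and interactions proportionally to its analogue for `p - 1` on the event that the
second variable precedes the first (`interWeight`), makes the oracle unbiased column by column. An
active variable never precedes the hashed one, so that event picks out exactly the interactions
with inactive variables. The recurrence of the hypergeometric weights and summation by parts bound
the normalising constants (`le_sum_sq_of_recurrence`), and hence the second moment of a column of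
the oracle by `(2 - q/p) q ℓ²` (`expect_oracleColumn_sq_le`). Since the columns are independent,
both the squared error of the oracle in each row and `‖b*‖²` have mean at most
`(2 - q/p) q ℓ² / L = r / (2 (1 + η))`.

*Leaving the ball.* An oracle column is a Rademacher sum, so its square has an exponential moment
(`expect_exp_sq_add_sum_sign_le`). By independence of the columns the excess of `‖b*‖ / √r` over
`1` has mean at most twice the second exponential of `ρ₂` (`expect_half_max_oracle_norm_le`).

Measurability of the estimator is not assumed: the fitted values are unique, being a projection
onto a convex set, and `exists_continuous_minimiser` provides coefficients depending continuously
on the data.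
-/

namespace MinWise

open scoped RealInnerProductSpace BigOperators

/-! ### The trade-off inequality -/

/-- The real-number inequality behind the risk bound, in units of the noise level. For a random
point `b` of the unit ball with multiplier `H`, it is applied with `W` the variance of the fit,
`P = E H`, `p` and `x` the norms of `E (H b)` and `E b`, `D` minus their inner product, `X` the
squared norm of the mean residual, and `β` the norm of the oracle. If the conclusion failed, `T + W`
would be small, where `T` is the excess of the left-hand side; then `X W` is small, while
`p ^ 2 + P D` is not, which contradicts `h3`. -/
theorem tradeoff_unit {W P D p x X β : ℝ} (hW : 0 ≤ W) (hp : 0 ≤ p) (hpP : p ≤ P)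
    (hx : 0 ≤ x) (hD : D ≤ p * x) (hX : 0 ≤ X)
    (hβ' : β ≤ 1)
    (h1 : (W + P + D) ^ 2 ≤ 1 - x ^ 2)
    (h3 : (p ^ 2 + P * D) ^ 2 * (1 - x ^ 2) ≤ X * W * (1 + 2 * (p ^ 2 + P * D))) :
    W + 2 * D + 2 * p * β ≤ 1 + 3 / 4 * β ^ 2 + 2 / 7 * X := by
  by_contra! hcon
  have hx1 : x ≤ 1 := by nlinarith [sq_nonneg (W + P + D)]
  have hc : W + P + D ≤ 1 - x ^ 2 / 2 := by
    refine abs_le_of_sq_le_sq' (a := W + P + D) (b := 1 - x ^ 2 / 2) ?_ ?_ |>.2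
    · nlinarith [sq_nonneg (x ^ 2)]
    · nlinarith
  set T := W + 2 * D + 2 * p * β - 3 / 4 * β ^ 2 - 1 with hT
  have hTX : 2 / 7 * X < T := by rw [hT]; linarith
  have hTpos : 0 < T := by linarith
  set g := 2 * p - 2 * p * β + 3 / 4 * β ^ 2 with hg
  have hDg : g - p + x ^ 2 / 2 < D := by rw [hg]; linarith
  -- minimise `g` over `β`: the minimiser is `β = 4 p / 3`
  have hgp : 2 * p - 4 / 3 * p ^ 2 ≤ g := by rw [hg]; nlinarith [sq_nonneg (β - 4 / 3 * p)]
  have hp6 : 6 / 11 < p := by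
    by_contra! hle
    have h4 : p * (1 - 11 / 6 * p) < 0 := by linarith [sq_nonneg (p - x)]
    have h5 : 0 ≤ p * (1 - 11 / 6 * p) := mul_nonneg hp (by linarith)
    linarith
  -- on `p ≤ 3 / 4` use `hgp`; beyond, the minimum over `β ≤ 1` is at `β = 1`
  have hg69 : 0.69 ≤ g := by
    rcases le_total p (3 / 4) with h | h
    · linarith [mul_nonneg (sub_nonneg.2 hp6.le) (sub_nonneg.2 h)]
    · linarith [mul_nonneg (sub_nonneg.2 h) (sub_nonneg.2 hβ'), sq_nonneg (1 - β)]
  have hK : T + W ≤ 1 - g - x ^ 2 := by rw [hT, hg]; linarith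
  have hK31 : T + W ≤ 0.31 - x ^ 2 := by linarith
  have hx56 : x ≤ 0.56 := by
    by_contra! h
    linarith [mul_le_mul h.le h.le (by norm_num) hx]
  have hK34 : T + W ≤ 0.339 * (1 - x) := by linarith [sq_nonneg (x - 0.1695)]
  -- the lower bound on `p ^ 2 + P D`, which stands for `E (H ⟪Λ, b - E b⟫)`
  have hq : 0.476 * (1 - x) ≤ p ^ 2 + P * D := by
    rcases le_total 0 D with h | h
    · have h2 : g ≤ p * (1 + x) := by linarith [sq_nonneg x]
      have h3 : p * g ≤ p ^ 2 + P * D := by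
        have := mul_le_mul_of_nonneg_left (show g ≤ p + D by linarith [sq_nonneg x]) hp
        linarith [mul_le_mul_of_nonneg_right hpP h]
      have h4 : g * g ≤ p * g * (1 + x) := by
        linarith [mul_le_mul_of_nonneg_left h2 (show 0 ≤ g by linarith)]
      have h5 : 0.476 ≤ p * g * (1 + x) := by
        linarith [mul_le_mul hg69 hg69 (by norm_num) (show 0 ≤ g by linarith)]
      have h6 : 0 ≤ p * g := mul_nonneg hp (by linarith)
      have h7 := mul_le_mul_of_nonneg_right h5 (sub_nonneg.2 hx1)
      linarith [mul_nonneg h6 (sq_nonneg x)]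
    · have h2 : P ≤ 1 - D := by linarith [sq_nonneg x]
      have h3 : 3 / 4 - D ≤ p := by
        by_contra! h4
        rcases le_total p (3 / 4) with h5 | h5
        · linarith [mul_nonneg hp (sub_nonneg.2 h5), sq_nonneg x]
        · have : 3 / 4 ≤ g := by
            linarith [mul_nonneg (sub_nonneg.2 h5) (sub_nonneg.2 hβ'), sq_nonneg (1 - β)]
          linarith [sq_nonneg x]
      have h4 : (3 / 4 - D) * (3 / 4 - D) ≤ p * p :=
        mul_le_mul h3 h3 (by linarith) hp
      linarith [mul_le_mul_of_nonneg_left h2 (neg_nonneg.2 h)]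
  set y := p ^ 2 + P * D with hy
  set a := 1 - x with ha
  have ha0 : 0 < a := by rw [ha]; linarith
  -- `X < 7 / 2 T`, and `T W ≤ (T + W)² / 4`
  have hXW : X * W ≤ 0.1006 * a ^ 2 := by
    have e1 : X * W ≤ 7 / 2 * (T * W) := by
      linarith [mul_le_mul_of_nonneg_right hTX.le hW]
    have e2 : T * W ≤ (T + W) ^ 2 / 4 := by linarith [sq_nonneg (T - W)]
    have e3 : (T + W) ^ 2 ≤ (0.339 * a) ^ 2 := by
      apply pow_le_pow_left₀ (by linarith) hK34
    linarith [sq_nonneg a]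
  have hy0 : 0 < y := lt_of_lt_of_le (by positivity) hq
  -- cancel `a` in `h3`, insert the lower bound for `y`, and read off a bound on `x` that is absurd
  have e4 : y ^ 2 * (a * (1 + x)) ≤ 0.1006 * a ^ 2 * (1 + 2 * y) := by
    calc y ^ 2 * (a * (1 + x)) = y ^ 2 * (1 - x ^ 2) := by rw [ha]; ring
      _ ≤ X * W * (1 + 2 * y) := h3
      _ ≤ _ := by gcongr
  have e5 : y ^ 2 * (1 + x) ≤ 0.1006 * a * (1 + 2 * y) := by
    have : a * (y ^ 2 * (1 + x)) ≤ a * (0.1006 * a * (1 + 2 * y)) := by linarith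
    exact le_of_mul_le_mul_left this ha0
  have e6 : 0.476 * a * (0.476 * a * (1 + x) - 0.2012 * a)
      ≤ y * (y * (1 + x) - 0.2012 * a) := by
    apply mul_le_mul hq _ _ hy0.le
    · linarith [mul_le_mul_of_nonneg_right hq (show 0 ≤ 1 + x by linarith)]
    · have h5 : 0 ≤ a * (0.476 * (1 + x) - 0.2012) := mul_nonneg ha0.le (by linarith)
      linarith
  have e7 : a * (a * (0.1307 + 0.2265 * x)) ≤ a * 0.1006 := by
    linarith [mul_nonneg (sq_nonneg a) hx, sq_nonneg a]
  have e8 := le_of_mul_le_mul_left e7 ha0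
  rw [ha] at e8
  linarith [mul_nonneg hx (sub_nonneg.2 hx56)]

/-- `tradeoff_unit` at noise level `N`, by homogeneity. -/
theorem tradeoff {N W P D p x X β : ℝ} (hN : 0 < N) (hW : 0 ≤ W) (hp : 0 ≤ p) (hpP : p ≤ P)
    (hx : 0 ≤ x) (hD : D ≤ p * x) (hX : 0 ≤ X) (hβ : β ≤ 1)
    (h1 : (W + P + D) ^ 2 ≤ N ^ 2 * (1 - x ^ 2))
    (h3 : (p ^ 2 + P * D) ^ 2 * (1 - x ^ 2) ≤ X * W * (N ^ 2 + 2 * (p ^ 2 + P * D))) :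
    W + 2 * D + 2 * p * β ≤ N * (1 + 3 / 4 * β ^ 2) + 2 / 7 * X := by
  have hN0 := hN.ne'
  have key := tradeoff_unit (W := W / N) (P := P / N) (D := D / N) (p := p / N) (x := x)
    (X := X / N) (β := β) (by positivity) (by positivity) (by gcongr) hx
    (by rw [div_mul_eq_mul_div]; gcongr) (by positivity) hβ ?_ ?_
  · have h := mul_le_mul_of_nonneg_left key hN.le
    have e1 : N * (W / N + 2 * (D / N) + 2 * (p / N) * β) = W + 2 * D + 2 * p * β := by
      field_simp
    have e2 : N * (1 + 3 / 4 * β ^ 2 + 2 / 7 * (X / N)) =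
        N * (1 + 3 / 4 * β ^ 2) + 2 / 7 * X := by field_simp
    rwa [e1, e2] at h
  · have e : (W / N + P / N + D / N) ^ 2 = (W + P + D) ^ 2 / N ^ 2 := by field_simp
    rw [e, div_le_iff₀ (by positivity)]
    linarith
  · have e : (p / N) ^ 2 + P / N * (D / N) = (p ^ 2 + P * D) / N ^ 2 := by field_simp
    have e' : ((p ^ 2 + P * D) / N ^ 2) ^ 2 * (1 - x ^ 2) =
        ((p ^ 2 + P * D) ^ 2 * (1 - x ^ 2)) / N ^ 4 := by field_simp
    have e'' : X / N * (W / N) * (1 + 2 * ((p ^ 2 + P * D) / N ^ 2)) =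
        X * W * (N ^ 2 + 2 * (p ^ 2 + P * D)) / N ^ 4 := by field_simp
    rw [e, e', e'']
    gcongr

/-! ### The risk of least squares over a ball -/

/-- Cauchy–Schwarz from the nonnegativity of a quadratic polynomial. -/
theorem sq_le_mul_of_forall_two_mul_le {J a c : ℝ} (h : ∀ t : ℝ, 2 * t * J ≤ a + t ^ 2 * c) :
    J ^ 2 ≤ a * c := by
  have := discrim_le_zero (a := c) (b := -2 * J) (c := a) (fun t => by nlinarith [h t])
  rw [discrim] at this
  nlinarith

theorem integrable_inner {Ω : Type*} [MeasurableSpace Ω] {P : Measure Ω}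
    {E : Type*} [NormedAddCommGroup E] [InnerProductSpace ℝ E]
    {X Y : Ω → E} (hX : MemLp X 2 P) (hY : MemLp Y 2 P) :
    Integrable (fun ω => ⟪X ω, Y ω⟫) P := by
  refine Integrable.mono' ((hX.integrable_norm_pow (by norm_num)).add
    (hY.integrable_norm_pow (by norm_num))) (hX.1.inner hY.1) (ae_of_all _ fun ω => ?_)
  have := abs_real_inner_le_norm (X ω) (Y ω)
  simp only [Real.norm_eq_abs, Pi.add_apply]
  simp
  nlinarith [sq_nonneg (‖X ω‖ - ‖Y ω‖), sq_nonneg (‖X ω‖ + ‖Y ω‖)]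

theorem integrable_normSq {Ω : Type*} [MeasurableSpace Ω] {P : Measure Ω}
    {E : Type*} [NormedAddCommGroup E]
    {X : Ω → E} (hX : MemLp X 2 P) :
    Integrable (fun ω => ‖X ω‖ ^ 2) P := by
  simpa using hX.integrable_norm_pow (by norm_num)

theorem sq_integral_inner_le {Ω : Type*} [MeasurableSpace Ω] {P : Measure Ω}
    {E : Type*} [NormedAddCommGroup E] [InnerProductSpace ℝ E]
    {X Y : Ω → E} (hX : MemLp X 2 P) (hY : MemLp Y 2 P) :
    (∫ ω, ⟪X ω, Y ω⟫ ∂P) ^ 2 ≤ (∫ ω, ‖X ω‖ ^ 2 ∂P) * ∫ ω, ‖Y ω‖ ^ 2 ∂P := by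
  refine sq_le_mul_of_forall_two_mul_le fun t => ?_
  rw [← integral_const_mul, ← integral_const_mul, ← integral_add (integrable_normSq hX)
    ((integrable_normSq hY).const_mul _)]
  refine integral_mono ((integrable_inner hX hY).const_mul _)
    ((integrable_normSq hX).add ((integrable_normSq hY).const_mul _)) fun ω => ?_
  have := sq_nonneg ‖X ω - t • Y ω‖
  rw [norm_sub_sq_real, inner_smul_right, norm_smul, mul_pow, Real.norm_eq_abs, sq_abs] at this
  simp only
  linarith

/-- If `b` maximises `u ↦ ⟪R, A u⟫` over the unit ball, then `A† R` is the nonnegative multiple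
`‖A† R‖ • b` of `b`: the stationarity condition with its multiplier. -/
theorem norm_adjoint_smul_of_isMax {E F : Type*} [NormedAddCommGroup E] [InnerProductSpace ℝ E]
    [CompleteSpace E] [NormedAddCommGroup F] [InnerProductSpace ℝ F] [CompleteSpace F]
    (A : E →L[ℝ] F) {R : F} {b : E} (hb : ‖b‖ ≤ 1)
    (h : ∀ u : E, ‖u‖ ≤ 1 → ⟪R, A u⟫ ≤ ⟪R, A b⟫) :
    ⟪A.adjoint R, b⟫ = ‖A.adjoint R‖ ∧ ‖A.adjoint R‖ • b = A.adjoint R := by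
  set z := A.adjoint R with hz
  have h1 : ∀ u, ⟪R, A u⟫ = ⟪z, u⟫ := fun u => (A.adjoint_inner_left u R).symm
  have h2 : ⟪z, b⟫ ≤ ‖z‖ := by
    have := real_inner_le_norm z b
    nlinarith [norm_nonneg z]
  have h3 : ‖z‖ ≤ ⟪z, b⟫ := by
    by_cases h0 : z = 0
    · simp [h0]
    have hn : 0 < ‖z‖ := norm_pos_iff.2 h0
    have := h (‖z‖⁻¹ • z) (by rw [norm_smul, norm_inv, norm_norm, inv_mul_cancel₀ hn.ne'])
    rw [h1, h1, inner_smul_right, real_inner_self_eq_norm_sq] at this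
    calc ‖z‖ = ‖z‖⁻¹ * ‖z‖ ^ 2 := by field_simp
      _ ≤ _ := this
  have h4 := le_antisymm h2 h3
  refine ⟨h4, ?_⟩
  have h5 : ‖‖z‖ • b - z‖ ^ 2 ≤ 0 := by
    rw [norm_sub_sq_real, inner_smul_left, norm_smul, norm_norm, real_inner_comm, h4]
    simp only [conj_trivial]
    nlinarith [mul_le_mul hb hb (norm_nonneg _) zero_le_one, sq_nonneg ‖z‖,
      mul_nonneg (sq_nonneg ‖z‖) (show 0 ≤ 1 - ‖b‖ * ‖b‖ by nlinarith [norm_nonneg b])]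
  have h6 : ‖‖z‖ • b - z‖ = 0 := by nlinarith [norm_nonneg (‖z‖ • b - z)]
  exact sub_eq_zero.1 (norm_eq_zero.1 h6)

set_option maxHeartbeats 1000000 in
/-- An oracle inequality for least squares over the unit ball, seen through an operator `A`, under
square-integrable noise with `E ‖A† ε‖² ≤ N²`; no bound on the noise beyond its second moment is
used. Writing `H = ‖A† R‖` for the multiplier of the residual `R`, all the moment identities come
from `A† ε = H b - Λ + A† A (b - E b)` with `Λ = E (H b)`, and they are combined in `tradeoff`. The
last term accounts for an oracle outside the unit ball. -/
theorem integral_sq_dist_constrained_le {Ω : Type*} [MeasurableSpace Ω] {P : Measure Ω}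
    [IsProbabilityMeasure P] {E F : Type*}
    [NormedAddCommGroup E] [InnerProductSpace ℝ E] [CompleteSpace E]
    [NormedAddCommGroup F] [InnerProductSpace ℝ F] [CompleteSpace F]
    (A : E →L[ℝ] F) {ε : Ω → F} (hε : MemLp ε 2 P) (hε0 : ∫ ω, ε ω ∂P = 0)
    {b : Ω → E} (hbm : AEStronglyMeasurable b P) (hb1 : ∀ ω, ‖b ω‖ ≤ 1) (f γ : F)
    (hopt : ∀ ω u, ‖u‖ ≤ 1 → ⟪f + γ + ε ω - A (b ω), A u⟫ ≤ ⟪f + γ + ε ω - A (b ω), A (b ω)⟫)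
    {N : ℝ} (hN : 0 < N) (hζN : ∫ ω, ‖A.adjoint (ε ω)‖ ^ 2 ∂P ≤ N ^ 2) (β : E) :
    ∫ ω, ‖A (b ω) - f‖ ^ 2 ∂P ≤ ‖γ‖ ^ 2 + 7 / 5 * ‖A β - f‖ ^ 2 + N * (1 + 4 / 5 * ‖β‖ ^ 2) +
      1 / 2 * max (‖β‖ - 1) 0 * ‖f + γ‖ ^ 2 := by
  classical
  have hb : MemLp b 2 P := (memLp_top_of_bound hbm 1 (ae_of_all _ hb1)).mono_exponent le_top
  have hAb : MemLp (fun ω => A (b ω)) 2 P := A.comp_memLp' hb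
  set R : Ω → F := fun ω => f + γ + ε ω - A (b ω) with hR
  have hRL : MemLp R 2 P := ((memLp_const (f + γ)).add hε).sub hAb
  set z : Ω → E := fun ω => A.adjoint (R ω) with hz
  have hzL : MemLp z 2 P := (A.adjoint).comp_memLp' hRL
  set H : Ω → ℝ := fun ω => ‖z ω‖ with hH
  have hHL : MemLp H 2 P := hzL.norm
  set ζ : Ω → E := fun ω => A.adjoint (ε ω) with hζ
  have hζL : MemLp ζ 2 P := (A.adjoint).comp_memLp' hε
  have hzb : ∀ ω, ⟪z ω, b ω⟫ = H ω := fun ω =>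
    (norm_adjoint_smul_of_isMax A (hb1 ω) (hopt ω)).1
  have hHb : ∀ ω, H ω • b ω = z ω := fun ω =>
    (norm_adjoint_smul_of_isMax A (hb1 ω) (hopt ω)).2
  have hH0 : ∀ ω, 0 ≤ H ω := fun ω => norm_nonneg _
  set m : E := ∫ ω, b ω ∂P with hm
  set v : F := f + γ - A m with hv
  set Λ : E := A.adjoint v with hΛ
  set c : Ω → E := fun ω => b ω - m with hc
  have hcL : MemLp c 2 P := hb.sub (memLp_const m)
  have hAc : MemLp (fun ω => A (c ω)) 2 P := A.comp_memLp' hcL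
  have hbI := hb.integrable one_le_two
  have hεI := hε.integrable one_le_two
  have hcI := hcL.integrable one_le_two
  have hHI := hHL.integrable one_le_two
  have hzI := hzL.integrable one_le_two
  have hc0 : ∫ ω, c ω ∂P = 0 := by
    rw [hc, integral_sub hbI (integrable_const _), integral_const]; simp [hm]
  have hAc0 : ∫ ω, A (c ω) ∂P = 0 := by
    rw [A.integral_comp_comm hcI, hc0, map_zero]
  have hζ0 : ∫ ω, ζ ω ∂P = 0 := by
    rw [hζ, (A.adjoint).integral_comp_comm hεI, hε0, map_zero]
  -- the stationarity equation of the constrained problem, centred at the mean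
  have hstat : ∀ ω, ζ ω = z ω - Λ + A.adjoint (A (c ω)) := fun ω => by
    simp only [hζ, hz, hΛ, hR, hv, hc, map_sub, map_add]; abel
  have hzΛ : ∫ ω, z ω ∂P = Λ := by
    have h1 : ∀ ω, z ω = ζ ω + Λ - A.adjoint (A (c ω)) := fun ω => by rw [hstat ω]; abel
    have h2 : Integrable (fun ω => A.adjoint (A (c ω))) P :=
      ((A.adjoint).comp_memLp' hAc).integrable one_le_two
    have h3 : ∫ ω, A.adjoint (A (c ω)) ∂P = 0 := by
      rw [(A.adjoint).integral_comp_comm (hAc.integrable one_le_two), hAc0, map_zero]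
    simp_rw [h1]
    have h4 : Integrable (fun ω => ζ ω + Λ) P :=
      (hζL.integrable one_le_two).add (integrable_const _)
    rw [integral_sub h4 h2,
      integral_add (hζL.integrable one_le_two) (integrable_const _), hζ0, h3]
    simp
  set W : ℝ := ∫ ω, ‖A (c ω)‖ ^ 2 ∂P with hW
  set PH : ℝ := ∫ ω, H ω ∂P with hPH
  set D : ℝ := -⟪Λ, m⟫ with hD
  have hinner_c : ∀ (u : E), ∫ ω, ⟪u, c ω⟫ ∂P = 0 := fun u => by
    rw [integral_inner hcI, hc0, inner_zero_right]
  have hinner_z : ∀ (u : E), ∫ ω, ⟪z ω, u⟫ ∂P = ⟪Λ, u⟫ := fun u => by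
    simp_rw [fun ω => real_inner_comm u (z ω)]
    rw [integral_inner hzI, hzΛ, real_inner_comm]
  have hzmI : Integrable (fun ω => ⟪z ω, m⟫) P := hzI.inner_const m
  have hΛcI : Integrable (fun ω => ⟪Λ, c ω⟫) P := hcI.const_inner Λ
  have hpt : ∀ ω, ⟪ζ ω, c ω⟫ = H ω - ⟪z ω, m⟫ - ⟪Λ, c ω⟫ + ‖A (c ω)‖ ^ 2 := fun ω => by
    have e1 : ⟪z ω, c ω⟫ = H ω - ⟪z ω, m⟫ := by rw [← hzb ω, ← inner_sub_right]
    have e2 : ⟪A.adjoint (A (c ω)), c ω⟫ = ‖A (c ω)‖ ^ 2 := by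
      rw [A.adjoint_inner_left, real_inner_self_eq_norm_sq]
    rw [hstat ω, inner_add_left, inner_sub_left, e1, e2]
  have hJ : ∫ ω, ⟪ζ ω, c ω⟫ ∂P = W + PH + D := by
    simp_rw [hpt]
    have i1 : Integrable (fun ω => H ω - ⟪z ω, m⟫) P := hHI.sub hzmI
    have i2 : Integrable (fun ω => H ω - ⟪z ω, m⟫ - ⟪Λ, c ω⟫) P := i1.sub hΛcI
    rw [integral_add i2 (integrable_normSq hAc), integral_sub i1 hΛcI, integral_sub hHI hzmI,
      hinner_c, hinner_z, hD]
    ring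
  have hcc : ∫ ω, ‖c ω‖ ^ 2 ∂P ≤ 1 - ‖m‖ ^ 2 := by
    have h1 : ∀ ω, ‖c ω‖ ^ 2 ≤ 1 - ‖m‖ ^ 2 - 2 * ⟪m, c ω⟫ := fun ω => by
      have h2 : ‖b ω‖ ^ 2 ≤ 1 := by
        have := hb1 ω; have := norm_nonneg (b ω); nlinarith
      have h3 : b ω = m + c ω := by simp [hc]
      rw [h3, norm_add_sq_real] at h2
      linarith
    calc ∫ ω, ‖c ω‖ ^ 2 ∂P ≤ ∫ ω, (1 - ‖m‖ ^ 2 - 2 * ⟪m, c ω⟫) ∂P :=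
          integral_mono (integrable_normSq hcL)
            ((integrable_const _).sub ((hcI.const_inner m).const_mul 2)) h1
      _ = 1 - ‖m‖ ^ 2 := by
          rw [integral_sub (integrable_const _) ((hcI.const_inner m).const_mul 2),
            integral_const_mul, hinner_c]
          simp
  -- Cauchy–Schwarz for `E ⟪A† ε, b - E b⟫`
  have h1 : (W + PH + D) ^ 2 ≤ N ^ 2 * (1 - ‖m‖ ^ 2) := by
    rw [← hJ]
    refine (sq_integral_inner_le hζL hcL).trans ?_
    exact mul_le_mul hζN hcc (integral_nonneg fun _ => sq_nonneg _) (sq_nonneg _)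
  have hm1 : 0 ≤ 1 - ‖m‖ ^ 2 := (integral_nonneg fun _ => sq_nonneg _).trans hcc
  have hpP : ‖Λ‖ ≤ PH := by
    rw [← hzΛ]; exact norm_integral_le_integral_norm _
  have hDp : D ≤ ‖Λ‖ * ‖m‖ := (neg_le_abs _).trans (abs_real_inner_le_norm _ _)
  set q : ℝ := ‖Λ‖ ^ 2 + PH * D with hq
  have hHc : ∀ ω, H ω * ⟪Λ, c ω⟫ = ⟪z ω, Λ⟫ - H ω * ⟪Λ, m⟫ := fun ω => by
    have e1 : ⟪Λ, c ω⟫ = ⟪b ω, Λ⟫ - ⟪Λ, m⟫ := by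
      simp only [hc, inner_sub_right, real_inner_comm Λ]
    rw [e1, ← hHb ω, real_inner_smul_left]
    ring
  have hHcI : Integrable (fun ω => H ω * ⟪Λ, c ω⟫) P := by
    simp_rw [hHc]; exact (hzI.inner_const Λ).sub (hHI.mul_const _)
  have hqint : ∫ ω, H ω * ⟪Λ, c ω⟫ ∂P = q := by
    simp_rw [hHc]
    rw [integral_sub (hzI.inner_const Λ) (hHI.mul_const _), hinner_z, integral_mul_const,
      real_inner_self_eq_norm_sq, hq, hD, hPH]
    ring
  set EH : ℝ := ∫ ω, ‖H ω‖ ^ 2 ∂P with hEH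
  -- the second moment of the multiplier: expand `‖A† ε - H (b - E b)‖² ≥ 0`
  have hEHle : EH * (1 - ‖m‖ ^ 2) ≤ N ^ 2 + 2 * q := by
    have hpt2 : ∀ ω, ‖H ω‖ ^ 2 * (1 - ‖m‖ ^ 2) ≤ ‖ζ ω‖ ^ 2 + 2 * (H ω * ⟪Λ, c ω⟫) := fun ω => by
      have e1 : ‖ζ ω - H ω • c ω‖ ^ 2 = ‖ζ ω‖ ^ 2 - 2 * (H ω * ⟪ζ ω, c ω⟫) + ‖H ω • c ω‖ ^ 2 := by
        rw [norm_sub_sq_real, inner_smul_right]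
      have e2 : ‖H ω • c ω‖ ^ 2 = H ω ^ 2 - 2 * (H ω * ⟪z ω, m⟫) + H ω ^ 2 * ‖m‖ ^ 2 := by
        rw [hc, smul_sub, hHb, norm_sub_sq_real, inner_smul_right, norm_smul, mul_pow,
          Real.norm_eq_abs, sq_abs]
      rw [e2, hpt] at e1
      rw [Real.norm_eq_abs, sq_abs]
      nlinarith [sq_nonneg ‖ζ ω - H ω • c ω‖, mul_nonneg (hH0 ω) (sq_nonneg ‖A (c ω)‖)]
    rw [hEH, ← integral_mul_const]
    calc _ ≤ ∫ ω, (‖ζ ω‖ ^ 2 + 2 * (H ω * ⟪Λ, c ω⟫)) ∂P :=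
          integral_mono ((integrable_normSq hHL).mul_const _)
            ((integrable_normSq hζL).add (hHcI.const_mul 2)) hpt2
      _ ≤ _ := by
          rw [integral_add (integrable_normSq hζL) (hHcI.const_mul 2), integral_const_mul, hqint]
          linarith
  -- Cauchy–Schwarz for `E (H ⟪v, A (b - E b)⟫)`, where `v` is the mean residual
  have hq2 : q ^ 2 ≤ ‖v‖ ^ 2 * EH * W := by
    have hX : MemLp (fun ω => H ω • v) 2 P := by
      refine (hHL.norm.const_mul ‖v‖).of_le (hHL.1.smul_const v) (ae_of_all _ fun ω => ?_)
      simp [norm_smul, mul_comm]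
    have h := sq_integral_inner_le hX hAc
    have e1 : ∀ ω, ⟪H ω • v, A (c ω)⟫ = H ω * ⟪Λ, c ω⟫ := fun ω => by
      rw [inner_smul_left, hΛ, A.adjoint_inner_left]; simp
    have e2 : ∫ ω, ‖H ω • v‖ ^ 2 ∂P = ‖v‖ ^ 2 * EH := by
      simp_rw [norm_smul, mul_pow]
      rw [integral_mul_const, hEH, mul_comm]
    simp_rw [e1] at h
    rwa [hqint, e2] at h
  have hW0 : 0 ≤ W := integral_nonneg fun _ => sq_nonneg _
  have h3 : q ^ 2 * (1 - ‖m‖ ^ 2) ≤ ‖v‖ ^ 2 * W * (N ^ 2 + 2 * q) := by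
    calc _ ≤ ‖v‖ ^ 2 * EH * W * (1 - ‖m‖ ^ 2) := mul_le_mul_of_nonneg_right hq2 hm1
      _ = ‖v‖ ^ 2 * W * (EH * (1 - ‖m‖ ^ 2)) := by ring
      _ ≤ _ := mul_le_mul_of_nonneg_left hEHle (by positivity)
  -- the error, split into the variance of the fit and its bias
  have herr : ∫ ω, ‖A (b ω) - f‖ ^ 2 ∂P = W + ‖A m - f‖ ^ 2 := by
    have e1 : ∀ ω, ‖A (b ω) - f‖ ^ 2 =
        ‖A (c ω)‖ ^ 2 + 2 * ⟪A m - f, A (c ω)⟫ + ‖A m - f‖ ^ 2 := fun ω => by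
      have : A (b ω) - f = A (c ω) + (A m - f) := by simp [hc]
      rw [this, norm_add_sq_real, real_inner_comm]
    have hI : Integrable (fun ω => ⟪A m - f, A (c ω)⟫) P :=
      (hAc.integrable one_le_two).const_inner _
    simp_rw [e1]
    have i1 : Integrable (fun ω => ‖A (c ω)‖ ^ 2 + 2 * ⟪A m - f, A (c ω)⟫) P :=
      (integrable_normSq hAc).add (hI.const_mul 2)
    rw [integral_add i1 (integrable_const _),
      integral_add (integrable_normSq hAc) (hI.const_mul 2), integral_const_mul,
      integral_inner (hAc.integrable one_le_two), hAc0]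
    simp [hW]
  have hbias : ‖A m - f‖ ^ 2 ≤ ‖γ‖ ^ 2 + 7 / 5 * ‖A β - f‖ ^ 2 + 2 * D + 2 * ‖Λ‖ * ‖β‖
      - 2 / 7 * ‖v‖ ^ 2 := by
    have e1 : A m - f = γ - v := by rw [hv]; abel
    have e2 : γ = v + A m - f := by rw [hv]; abel
    have e3 : ⟪γ, v⟫ = ‖v‖ ^ 2 - D - ⟪f, v⟫ := by
      conv_lhs => rw [e2]
      rw [inner_sub_left, inner_add_left, real_inner_self_eq_norm_sq, ← A.adjoint_inner_right,
        real_inner_comm, hD]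
      ring
    have e4 : ⟪f, v⟫ = ⟪β, Λ⟫ - ⟪A β - f, v⟫ := by
      rw [inner_sub_left, hΛ, A.adjoint_inner_right]; ring
    have e5 : ⟪β, Λ⟫ ≤ ‖Λ‖ * ‖β‖ := by
      rw [mul_comm]; exact real_inner_le_norm _ _
    have e6 : -⟪A β - f, v⟫ ≤ ‖A β - f‖ * ‖v‖ := (neg_le_abs _).trans (abs_real_inner_le_norm _ _)
    rw [e1, norm_sub_sq_real, e3, e4]
    nlinarith [sq_nonneg (7 / 5 * ‖A β - f‖ - ‖v‖)]
  -- the multiplier is controlled by the size of the data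
  have hPF : PH ≤ ‖f + γ‖ ^ 2 / 4 + N := by
    have hpt3 : ∀ ω, H ω ≤ ‖f + γ‖ ^ 2 / 4 + (⟪m, ζ ω⟫ + ⟪ζ ω, c ω⟫) := fun ω => by
      have e1 : H ω = ⟪f + γ, A (b ω)⟫ + ⟪ζ ω, b ω⟫ - ‖A (b ω)‖ ^ 2 := by
        rw [← hzb ω]
        simp only [hz, hζ, A.adjoint_inner_left, hR, inner_sub_left, inner_add_left,
          real_inner_self_eq_norm_sq]
      have e2 : ⟪ζ ω, b ω⟫ = ⟪m, ζ ω⟫ + ⟪ζ ω, c ω⟫ := by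
        rw [real_inner_comm (ζ ω) m, ← inner_add_right]; simp [hc]
      have e3 := real_inner_le_norm (f + γ) (A (b ω))
      rw [e1, e2]
      nlinarith [sq_nonneg (‖f + γ‖ / 2 - ‖A (b ω)‖)]
    have hmI : Integrable (fun ω => ⟪m, ζ ω⟫) P := (hζL.integrable one_le_two).const_inner m
    have i1 : Integrable (fun ω => ⟪m, ζ ω⟫ + ⟪ζ ω, c ω⟫) P :=
      hmI.add (integrable_inner hζL hcL)
    have h4 : PH ≤ ‖f + γ‖ ^ 2 / 4 + (W + PH + D) := by
      calc PH ≤ ∫ ω, (‖f + γ‖ ^ 2 / 4 + (⟪m, ζ ω⟫ + ⟪ζ ω, c ω⟫)) ∂P :=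
            integral_mono hHI ((integrable_const _).add i1) hpt3
        _ = _ := by
            rw [integral_add (integrable_const _) i1,
              integral_add hmI (integrable_inner hζL hcL), hJ,
              integral_inner (hζL.integrable one_le_two), hζ0]
            simp
    have h5 : W + PH + D ≤ N := by
      refine abs_le_of_sq_le_sq' (h1.trans ?_) hN.le |>.2
      nlinarith [sq_nonneg N, mul_nonneg (sq_nonneg N) (sq_nonneg ‖m‖)]
    linarith
  rw [herr]
  -- for `‖β‖ > 1` apply the trade-off at `1`; the excess costs `2 (‖β‖ - 1) ‖Λ‖`
  rcases le_total ‖β‖ 1 with hβ | hβ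
  · have := tradeoff hN hW0 (norm_nonneg Λ) hpP (norm_nonneg m) hDp (sq_nonneg ‖v‖) hβ h1 h3
    rw [max_eq_right (by linarith)]
    nlinarith [mul_nonneg hN.le (sq_nonneg ‖β‖)]
  · have := tradeoff hN hW0 (norm_nonneg Λ) hpP (norm_nonneg m) hDp (sq_nonneg ‖v‖) le_rfl h1 h3
    rw [max_eq_left (by linarith)]
    have h6 : (‖β‖ - 1) * ‖Λ‖ ≤ (‖β‖ - 1) * (‖f + γ‖ ^ 2 / 4 + N) :=
      mul_le_mul_of_nonneg_left (hpP.trans hPF) (by linarith)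
    nlinarith [mul_nonneg hN.le (sq_nonneg (‖β‖ - 5 / 4))]

/-! ### Continuous selection of minimisers -/

/-- A linear map between finite-dimensional inner product spaces has a linear section over its range
that does not increase the norm of the preimage: invert it on the orthogonal complement of its
kernel. -/
theorem exists_section_norm_le {E F : Type*} [NormedAddCommGroup E] [InnerProductSpace ℝ E]
    [FiniteDimensional ℝ E] [NormedAddCommGroup F] [InnerProductSpace ℝ F] (A : E →L[ℝ] F) :
    ∃ G : F →ₗ[ℝ] E, ∀ b, ‖G (A b)‖ ≤ ‖b‖ ∧ A (G (A b)) = A b := by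
  set K : Submodule ℝ E := LinearMap.ker (A : E →ₗ[ℝ] F) with hK
  set f : Kᗮ →ₗ[ℝ] F := (A : E →ₗ[ℝ] F).domRestrict Kᗮ with hf
  have hinj : LinearMap.ker f = ⊥ := by
    rw [LinearMap.ker_eq_bot']
    intro x hx
    have h1 : (x : E) ∈ K := by simpa [hK, hf] using hx
    have h2 := Submodule.inner_right_of_mem_orthogonal h1 x.2
    exact Subtype.ext (inner_self_eq_zero.1 h2)
  obtain ⟨g, hg⟩ := f.exists_leftInverse_of_injective hinj
  refine ⟨Kᗮ.subtype ∘ₗ g, fun b => ?_⟩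
  have hdec : A (Kᗮ.orthogonalProjectionOnto b : E) = A b := by
    have h1 : b - (Kᗮ.orthogonalProjectionOnto b : E) ∈ K := by
      have := Submodule.sub_starProjection_mem_orthogonal (K := Kᗮ) b
      rwa [Submodule.orthogonal_orthogonal] at this
    have h2 : A (b - (Kᗮ.orthogonalProjectionOnto b : E)) = 0 := h1
    rw [map_sub, sub_eq_zero] at h2
    exact h2.symm
  have hG : g (A b) = Kᗮ.orthogonalProjectionOnto b := by
    rw [← hdec]
    exact LinearMap.congr_fun hg (Kᗮ.orthogonalProjectionOnto b)
  simp only [LinearMap.comp_apply, Submodule.subtype_apply, hG]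
  exact ⟨Kᗮ.norm_orthogonalProjectionOnto_apply_le b, hdec⟩

theorem inner_le_of_isMin {E F : Type*} [NormedAddCommGroup E] [InnerProductSpace ℝ E]
    [NormedAddCommGroup F] [InnerProductSpace ℝ F] (A : E →L[ℝ] F) {v : F} {b : E}
    (hb : ‖b‖ ≤ 1) (h : ∀ u, ‖u‖ ≤ 1 → ‖v - A b‖ ≤ ‖v - A u‖) {u : E} (hu : ‖u‖ ≤ 1) :
    ⟪v - A b, A u⟫ ≤ ⟪v - A b, A b⟫ := by
  set K : Set F := A '' Metric.closedBall 0 1 with hK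
  have hKc : Convex ℝ K := (convex_closedBall 0 1).linear_image (A : E →ₗ[ℝ] F)
  have hbK : A b ∈ K := ⟨b, by simpa using hb, rfl⟩
  have huK : A u ∈ K := ⟨u, by simpa using hu, rfl⟩
  have h1 := (norm_eq_iInf_iff_real_inner_le_zero hKc hbK (u := v)).1 (le_antisymm ?_ ?_) _ huK
  · rw [inner_sub_right] at h1; linarith
  · have : Nonempty K := ⟨⟨_, hbK⟩⟩
    refine le_ciInf fun w => ?_
    obtain ⟨u', hu', hw⟩ := w.2
    rw [← hw]
    exact h u' (by simpa using hu')
  · exact ciInf_le ⟨0, by rintro _ ⟨w, rfl⟩; exact norm_nonneg _⟩ (⟨_, hbK⟩ : K)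

/-- The fitted value of the constrained least squares problem is a contraction of the data. -/
theorem norm_sub_le_of_inner_le {E F : Type*} [NormedAddCommGroup E] [InnerProductSpace ℝ E]
    [NormedAddCommGroup F] [InnerProductSpace ℝ F] (A : E →L[ℝ] F) {v v' : F} {b b' : E}
    (hb : ‖b‖ ≤ 1) (hb' : ‖b'‖ ≤ 1)
    (h : ∀ u, ‖u‖ ≤ 1 → ⟪v - A b, A u⟫ ≤ ⟪v - A b, A b⟫)
    (h' : ∀ u, ‖u‖ ≤ 1 → ⟪v' - A b', A u⟫ ≤ ⟪v' - A b', A b'⟫) :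
    ‖A b - A b'‖ ≤ ‖v - v'‖ := by
  have h1 := h b' hb'
  have h2 := h' b hb
  have h3 : ‖A b - A b'‖ ^ 2 ≤ ⟪v - v', A b - A b'⟫ := by
    rw [← real_inner_self_eq_norm_sq]
    simp only [inner_sub_left, inner_sub_right] at h1 h2 ⊢
    linarith
  have h4 := real_inner_le_norm (v - v') (A b - A b')
  rcases (norm_nonneg (A b - A b')).eq_or_lt with h5 | h5
  · rw [← h5]; exact norm_nonneg _
  · refine le_of_mul_le_mul_right ?_ h5
    nlinarith

/-- Constrained least squares has a continuous selection of minimisers. -/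
theorem exists_continuous_minimiser {E F : Type*} [NormedAddCommGroup E] [InnerProductSpace ℝ E]
    [FiniteDimensional ℝ E] [NormedAddCommGroup F] [InnerProductSpace ℝ F] [FiniteDimensional ℝ F]
    (A : E →L[ℝ] F) : ∃ B : F → E, Continuous B ∧ ∀ v, ‖B v‖ ≤ 1 ∧
      ∀ u, ‖u‖ ≤ 1 → ⟪v - A (B v), A u⟫ ≤ ⟪v - A (B v), A (B v)⟫ := by
  obtain ⟨G, hG⟩ := exists_section_norm_le A
  have hex : ∀ v : F, ∃ b : E, ‖b‖ ≤ 1 ∧ ∀ u, ‖u‖ ≤ 1 → ⟪v - A b, A u⟫ ≤ ⟪v - A b, A b⟫ := by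
    intro v
    obtain ⟨b, hb, hmin⟩ := (isCompact_closedBall (0 : E) 1).exists_isMinOn
      ⟨0, by simp⟩ (f := fun u => ‖v - A u‖) (by fun_prop)
    have hb' : ‖b‖ ≤ 1 := by simpa using hb
    exact ⟨b, hb', fun u hu => inner_le_of_isMin A hb'
      (fun w hw => hmin (show w ∈ Metric.closedBall (0 : E) 1 by simpa using hw)) hu⟩
  choose b hb hopt using hex
  have hlip : LipschitzWith 1 fun v => A (b v) := LipschitzWith.of_dist_le_mul fun v v' => by
    rw [dist_eq_norm, dist_eq_norm, NNReal.coe_one, one_mul]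
    exact norm_sub_le_of_inner_le A (hb v) (hb v') (hopt v) (hopt v')
  refine ⟨fun v => G (A (b v)), G.continuous_of_finiteDimensional.comp hlip.continuous,
    fun v => ⟨(hG _).1.trans (hb v), ?_⟩⟩
  simpa only [(hG _).2] using hopt v

/-! ### Hypergeometric probabilities of being hashed -/
theorem sum_range_mul_sub_succ (a : ℕ → ℝ) (p m : ℕ) :
    ∑ j ∈ Finset.range m, ((p : ℝ) - 1 - j) * (a j - a (j + 1)) =
      p * a 0 - ∑ j ∈ Finset.range m, a j - (p - m) * a m := by
  induction m with
  | zero => simp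
  | succ m ih =>
    rw [Finset.sum_range_succ, ih, Finset.sum_range_succ]
    push_cast
    ring

theorem sum_range_succ_mul_mul_sub_succ (a : ℕ → ℝ) (p m : ℕ) :
    ∑ j ∈ Finset.range m, ((j : ℝ) + 1) * (((p : ℝ) - 1 - j) * (a j - a (j + 1))) =
      (p + 1) * ∑ j ∈ Finset.range m, a j - 2 * ∑ j ∈ Finset.range m, ((j : ℝ) + 1) * a j
        - m * (p - m) * a m := by
  induction m with
  | zero => simp
  | succ m ih =>
    rw [Finset.sum_range_succ, ih, Finset.sum_range_succ, Finset.sum_range_succ]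
    push_cast
    ring

/-- The sum of squares of a sequence obeying the hypergeometric recurrence
`(p - 1 - j) (u_j - u_{j+1}) = (q - 1) u_j` from `u_0 = 1`. Summation by parts evaluates `∑ u_j ^ 2`
in terms of `d = ∑ (u_j - u_{j+1})²`, and Cauchy–Schwarz applied to `∑ (u_j² - u_{j+1}²) = 1`
bounds `d` from below as long as `∑ u_j ^ 2` is small. -/
theorem le_sum_sq_of_recurrence {p q : ℕ} (hq : 1 ≤ q) (hqp : q ≤ p) {u : ℕ → ℝ} (h0 : u 0 = 1)
    (hp : u p = 0) (hrec : ∀ j < p, ((p : ℝ) - 1 - j) * (u j - u (j + 1)) = (q - 1) * u j) :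
    p ≤ (2 - (q : ℝ) / p) * q * ∑ j ∈ Finset.range p, u j ^ 2 := by
  set s := ∑ j ∈ Finset.range p, u j ^ 2 with hs
  set d := ∑ j ∈ Finset.range p, (u j - u (j + 1)) ^ 2 with hd
  have hd0 : 0 ≤ d := Finset.sum_nonneg fun _ _ => sq_nonneg _
  have htel : ∑ j ∈ Finset.range p, (u j ^ 2 - u (j + 1) ^ 2) = 1 := by
    rw [Finset.sum_range_sub', h0, hp]; norm_num
  have hs' : ∑ j ∈ Finset.range p, u (j + 1) ^ 2 = s - 1 := by
    rw [Finset.sum_sub_distrib] at htel; linarith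
  have h1 : (2 * q - 1) * s = p + (q - 1) * (1 + d) / 2 := by
    have e1 := sum_range_mul_sub_succ (fun j => u j ^ 2) p p
    have e2 : ∑ j ∈ Finset.range p, ((p : ℝ) - 1 - j) * (u j ^ 2 - u (j + 1) ^ 2) =
        ∑ j ∈ Finset.range p, ((q : ℝ) - 1) *
          (3 / 2 * u j ^ 2 + 1 / 2 * u (j + 1) ^ 2 - 1 / 2 * (u j - u (j + 1)) ^ 2) := by
      refine Finset.sum_congr rfl fun j hj => ?_
      have := hrec j (Finset.mem_range.1 hj)
      calc _ = (((p : ℝ) - 1 - j) * (u j - u (j + 1))) * (u j + u (j + 1)) := by ring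
        _ = _ := by rw [this]; ring
    rw [e1, ← Finset.mul_sum, Finset.sum_sub_distrib, Finset.sum_add_distrib, ← Finset.mul_sum,
      ← Finset.mul_sum, ← Finset.mul_sum, hs', ← hs, ← hd] at e2
    simp only [h0] at e2
    linarith
  have h2 : (1 + d) ^ 2 ≤ 4 * d * s := by
    have e1 := Finset.sum_mul_sq_le_sq_mul_sq (Finset.range p) (fun j => u j - u (j + 1))
      (fun j => u j + u (j + 1))
    have e2 : ∑ j ∈ Finset.range p, (u j - u (j + 1)) * (u j + u (j + 1)) = 1 := by
      rw [← htel]; exact Finset.sum_congr rfl fun j _ => by ring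
    have e3 : ∑ j ∈ Finset.range p, (u j + u (j + 1)) ^ 2 = 4 * s - 2 - d := by
      have : ∀ j, (u j + u (j + 1)) ^ 2 =
          2 * u j ^ 2 + 2 * u (j + 1) ^ 2 - (u j - u (j + 1)) ^ 2 := fun j => by ring
      simp_rw [this]
      rw [Finset.sum_sub_distrib, Finset.sum_add_distrib, ← Finset.mul_sum, ← Finset.mul_sum, hs',
        ← hs, ← hd]
      ring
    rw [e2, e3] at e1
    linarith
  have hq' : (1 : ℝ) ≤ q := by exact_mod_cast hq
  have hqp' : (q : ℝ) ≤ p := by exact_mod_cast hqp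
  have hp0 : (0 : ℝ) < p := by linarith
  set δ : ℝ := (q : ℝ) / p with hδ
  have hδ0 : 0 < δ := by positivity
  have hδ1 : δ ≤ 1 := (div_le_one hp0).2 hqp'
  have hqδ : (q : ℝ) = δ * p := by rw [hδ]; field_simp
  by_contra! hlt
  have hlt' : s * (δ * (2 - δ)) < 1 := by
    have : (s * (δ * (2 - δ))) * p < 1 * p := by
      calc _ = (2 - δ) * (δ * p) * s := by ring
        _ < _ := by rw [← hqδ]; linarith
    exact lt_of_mul_lt_mul_right this hp0.le
  have hdpos : 0 < d := by
    rcases hd0.lt_or_eq with h | h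
    · exact h
    · rw [← h] at h2; norm_num at h2
  -- `d` exceeds the smaller root `δ / (2 - δ)` of `δ (2 - δ) (1 + d)² = 4 d`
  have h3 : δ < d * (2 - δ) := by
    have e1 : (1 + d) ^ 2 * (δ * (2 - δ)) < 4 * d := by
      have := mul_le_mul_of_nonneg_right h2 (show 0 ≤ δ * (2 - δ) by nlinarith)
      nlinarith
    have e2 : (d * (2 - δ) - δ) * (d * δ - (2 - δ)) < 0 := by nlinarith
    by_contra! h
    have e3 : d * (2 - δ) < δ := by
      refine h.lt_of_ne fun h' => ?_
      rw [h', sub_self, zero_mul] at e2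
      exact lt_irrefl _ e2
    have e4 : d < 1 := by nlinarith
    have e5 : d * δ - (2 - δ) < 0 := by
      have : d * δ ≤ d * 1 := mul_le_mul_of_nonneg_left hδ1 hd0
      linarith
    nlinarith [mul_pos_of_neg_of_neg (sub_neg.2 e3) e5]
  have h4 : (2 * q - 1) * (s * (δ * (2 - δ))) < 2 * q - 1 := by
    nlinarith
  have h5 : (2 * q - 1) * (s * (δ * (2 - δ))) =
      q * (2 - δ) + δ * (q - 1) * ((1 + d) * (2 - δ) / 2) := by
    calc _ = ((2 * q - 1) * s) * (δ * (2 - δ)) := by ring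
      _ = (δ * p) * (2 - δ) + δ * (q - 1) * ((1 + d) * (2 - δ) / 2) := by rw [h1]; ring
      _ = _ := by rw [← hqδ]
  have h6 : δ * (q - 1) * 1 ≤ δ * (q - 1) * ((1 + d) * (2 - δ) / 2) :=
    mul_le_mul_of_nonneg_left (by linarith) (mul_nonneg hδ0.le (by linarith))
  linarith

/-- Summation by parts against the weights `j + 1`, where
`u_j² - u_{j+1}² ≤ 2 u_j (u_j - u_{j+1})`. -/
theorem le_sum_succ_mul_sq_of_recurrence {p q : ℕ} {u : ℕ → ℝ}
    (hrec : ∀ j < p, ((p : ℝ) - 1 - j) * (u j - u (j + 1)) = (q - 1) * u j) :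
    (p + 1) * ∑ j ∈ Finset.range p, u j ^ 2 ≤
      2 * q * ∑ j ∈ Finset.range p, ((j : ℝ) + 1) * u j ^ 2 := by
  have e1 := sum_range_succ_mul_mul_sub_succ (fun j => u j ^ 2) p p
  have e2 : ∑ j ∈ Finset.range p, ((j : ℝ) + 1) * (((p : ℝ) - 1 - j) *
      (u j ^ 2 - u (j + 1) ^ 2)) ≤
      ∑ j ∈ Finset.range p, (2 * ((q : ℝ) - 1)) * (((j : ℝ) + 1) * u j ^ 2) := by
    refine Finset.sum_le_sum fun j hj => ?_
    have hj := Finset.mem_range.1 hj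
    have hjp : (0 : ℝ) ≤ (p : ℝ) - 1 - j := by
      have : (j : ℝ) + 1 ≤ p := by exact_mod_cast hj
      linarith
    have h := hrec j hj
    have h3 : ((p : ℝ) - 1 - j) * (u j ^ 2 - u (j + 1) ^ 2) ≤ 2 * ((q : ℝ) - 1) * u j ^ 2 := by
      calc _ = 2 * u j * (((p : ℝ) - 1 - j) * (u j - u (j + 1))) -
            ((p : ℝ) - 1 - j) * (u j - u (j + 1)) ^ 2 := by ring
        _ ≤ 2 * u j * (((p : ℝ) - 1 - j) * (u j - u (j + 1))) :=
          sub_le_self _ (mul_nonneg hjp (sq_nonneg _))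
        _ = _ := by rw [h]; ring
    nlinarith [mul_le_mul_of_nonneg_left h3 (show (0 : ℝ) ≤ j + 1 by positivity)]
  rw [e1, ← Finset.mul_sum] at e2
  simp only [sub_self, mul_zero, zero_mul, sub_zero] at e2
  linarith

/-- The conditional probability that variable `k` attains the minimum over a set of `q` variables,
out of `p`, given that `π k = j` (positions start at `0`): the other `q - 1` variables take
positions among the `p - 1 - j` later ones. The value `0` at `j ≥ p` makes the recurrence hold up to
the last position. -/
noncomputable def hashProb (p q j : ℕ) : ℝ :=
  if j < p then ((p - 1 - j).descFactorial (q - 1) : ℝ) / ((p - 1).descFactorial (q - 1) : ℝ) else 0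

theorem hashProb_nonneg (p q j : ℕ) : 0 ≤ hashProb p q j := by
  unfold hashProb; split_ifs <;> positivity

theorem hashProb_le_one (p q j : ℕ) : hashProb p q j ≤ 1 := by
  unfold hashProb
  split_ifs
  · exact div_le_one_of_le₀ (by exact_mod_cast Nat.descFactorial_le _ (by omega)) (by positivity)
  · exact zero_le_one

theorem hashProb_self (p q : ℕ) : hashProb p q p = 0 := by simp [hashProb]

theorem hashProb_zero {p q : ℕ} (hq : 1 ≤ q) (hqp : q ≤ p) : hashProb p q 0 = 1 := by
  have : (p - 1).descFactorial (q - 1) ≠ 0 := by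
    rw [Ne, Nat.descFactorial_eq_zero_iff_lt]; omega
  rw [hashProb, if_pos (by omega), Nat.sub_zero, div_self (by exact_mod_cast this)]

theorem hashProb_recurrence {p q j : ℕ} (hq : 1 ≤ q) (hj : j < p) :
    ((p : ℝ) - 1 - j) * (hashProb p q j - hashProb p q (j + 1)) = (q - 1) * hashProb p q j := by
  obtain ⟨k, rfl⟩ : ∃ k, q = k + 1 := ⟨q - 1, by omega⟩
  rcases (Nat.succ_le_of_lt hj).lt_or_eq with h | h
  · obtain ⟨m, rfl⟩ : ∃ m, p = j + 2 + m := ⟨p - (j + 2), by omega⟩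
    rw [hashProb, hashProb, if_pos hj, if_pos (by omega)]
    have e1 : j + 2 + m - 1 - j = m + 1 := by omega
    have e2 : j + 2 + m - 1 - (j + 1) = m := by omega
    rw [e1, e2, ← sub_div, mul_div_assoc', mul_div_assoc']
    congr 1
    simp only [Nat.add_sub_cancel]
    push_cast
    rcases le_or_gt k (m + 1) with hk | hk
    · have := Nat.succ_descFactorial m k
      have h2 : ((m : ℝ) + 1 - k) * ((m + 1).descFactorial k : ℝ) =
          (m + 1) * m.descFactorial k := by
        have := congrArg (Nat.cast (R := ℝ)) this
        rw [Nat.cast_mul, Nat.cast_sub hk] at this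
        push_cast at this
        exact this
      linarith
    · rw [Nat.descFactorial_eq_zero_iff_lt.2 hk, Nat.descFactorial_eq_zero_iff_lt.2 (by omega)]
      simp
  · obtain rfl : p = j + 1 := by omega
    rw [hashProb_self, hashProb, if_pos hj]
    rcases Nat.eq_zero_or_pos k with rfl | hk
    · simp
    · rw [Nat.descFactorial_eq_zero_iff_lt.2 (by simp; omega)]
      simp

theorem le_sum_hashProb_sq {p q : ℕ} (hq : 1 ≤ q) (hqp : q ≤ p) :
    p ≤ (2 - (q : ℝ) / p) * q * ∑ j ∈ Finset.range p, hashProb p q j ^ 2 :=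
  le_sum_sq_of_recurrence hq hqp (hashProb_zero hq hqp) (hashProb_self p q)
    fun _ => hashProb_recurrence hq

theorem le_sum_succ_mul_hashProb_sq {p q : ℕ} (hq : 1 ≤ q) (hqp : q ≤ p) :
    (p + 1) * p ≤ 2 * q * ((2 - (q : ℝ) / p) * q) *
      ∑ j ∈ Finset.range p, ((j : ℝ) + 1) * hashProb p q j ^ 2 := by
  have h1 := le_sum_hashProb_sq hq hqp
  have h2 := le_sum_succ_mul_sq_of_recurrence (p := p)
    fun _ => hashProb_recurrence hq
  have hA : 0 ≤ (2 - (q : ℝ) / p) * q := by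
    have : (q : ℝ) / p ≤ 1 := div_le_one_of_le₀ (by exact_mod_cast hqp) (by positivity)
    have : (0 : ℝ) ≤ 2 - (q : ℝ) / p := by linarith
    positivity
  have h3 := mul_le_mul_of_nonneg_left h2 hA
  have h4 := mul_le_mul_of_nonneg_left h1 (show (0 : ℝ) ≤ p + 1 by positivity)
  linarith

/-! ### Averages over uniform permutations -/

/-- Let `D` be supported on permutations that place `B` at or before position `j`, and invariant
under swaps of variables outside `B`. Swapping two variables outside `B ∪ z` exchanges the events
indexed by `insert x z` and `insert y z`; averaging over the free variables evaluates the
probability that all of `z` lies after position `j`. -/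
theorem expect_mul_prod_lt {p : ℕ} (B : Finset (Fin p)) (D : Equiv.Perm (Fin p) → ℝ) (j : Fin p)
    (hinv : ∀ x ∉ B, ∀ y ∉ B, ∀ π, D (π * Equiv.swap x y) = D π)
    (hsupp : ∀ π, D π ≠ 0 → ∀ b ∈ B, π b ≤ j) (z : Finset (Fin p)) (hz : Disjoint z B) :
    (𝔼 π, D π * ∏ x ∈ z, (if j < π x then 1 else 0)) * ((p - B.card).descFactorial z.card : ℝ) =
      (𝔼 π, D π) * ((p - 1 - j).descFactorial z.card : ℝ) := by
  classical
  induction z using Finset.induction_on with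
  | empty => simp
  | insert x z hx ih =>
    rw [Finset.disjoint_insert_left] at hz
    have ih := ih hz.2
    set G : Finset (Fin p) → ℝ := fun z => 𝔼 π, D π * ∏ x ∈ z, (if j < π x then 1 else 0) with hG
    set U : Finset (Fin p) := Finset.univ \ (B ∪ z) with hU
    have hUc : U.card = p - B.card - z.card := by
      rw [hU, Finset.card_sdiff_of_subset (Finset.subset_univ _),
        Finset.card_union_of_disjoint hz.2.symm]
      simp [Nat.sub_sub]
    have hsym : ∀ y ∈ U, G (insert y z) = G (insert x z) := fun y hy => by
      simp only [hU, Finset.mem_sdiff, Finset.mem_univ, true_and, Finset.mem_union,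
        not_or] at hy
      refine Fintype.expect_equiv (Equiv.mulRight (Equiv.swap x y)) _ _ fun π => ?_
      rw [Equiv.coe_mulRight, hinv x hz.1 y hy.1, Finset.prod_insert hy.2, Finset.prod_insert hx]
      congr 2
      · simp
      · refine Finset.prod_congr rfl fun w hw => ?_
        rw [Equiv.Perm.mul_apply, Equiv.swap_apply_of_ne_of_ne]
        · rintro rfl; exact hx hw
        · rintro rfl; exact hy.2 hw
    have hpt : ∀ π, ∑ y ∈ U, D π * ∏ x ∈ insert y z, (if j < π x then (1 : ℝ) else 0) =
        (D π * ∏ x ∈ z, (if j < π x then 1 else 0)) * ((p - 1 - j - z.card : ℕ) : ℝ) := fun π => by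
      have e1 : ∀ y ∈ U, D π * ∏ x ∈ insert y z, (if j < π x then (1 : ℝ) else 0) =
          (D π * ∏ x ∈ z, (if j < π x then 1 else 0)) * (if j < π y then 1 else 0) := fun y hy => by
        rw [Finset.prod_insert (by simp [hU] at hy; tauto)]; ring
      rw [Finset.sum_congr rfl e1, ← Finset.mul_sum]
      by_cases h0 : D π = 0
      · simp [h0]
      by_cases h1 : ∀ w ∈ z, j < π w
      · congr 1
        rw [Finset.sum_boole]
        congr 1
        have e2 : U.filter (fun y => j < π y) =
            ((Finset.Ioi j).map π.symm.toEmbedding) \ z := by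
          ext y
          simp only [hU, Finset.mem_filter, Finset.mem_sdiff, Finset.mem_univ, true_and,
            Finset.mem_union, not_or, Finset.mem_map_equiv, Equiv.symm_symm, Finset.mem_Ioi]
          constructor
          · rintro ⟨⟨_, h⟩, h'⟩; exact ⟨h', h⟩
          · rintro ⟨h', h⟩
            exact ⟨⟨fun hB => absurd (hsupp π h0 y hB) (not_le.2 h'), h⟩, h'⟩
        rw [e2, Finset.card_sdiff_of_subset, Finset.card_map, Fin.card_Ioi]
        intro w hw
        simpa using h1 w hw
      · push Not at h1
        obtain ⟨w, hw, hw'⟩ := h1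
        rw [Finset.prod_eq_zero hw (by simp [not_lt.2 hw'])]
        simp
    have hrec : (U.card : ℝ) * G (insert x z) = G z * ((p - 1 - j - z.card : ℕ) : ℝ) := by
      rw [← nsmul_eq_mul, ← Finset.sum_const, ← Finset.sum_congr rfl hsym, hG]
      simp only
      rw [← Finset.expect_sum_comm, Finset.expect_congr rfl fun π _ => hpt π, Finset.expect_mul]
    rw [Finset.card_insert_of_notMem hx, Nat.descFactorial_succ, Nat.descFactorial_succ,
      Nat.cast_mul, Nat.cast_mul, ← hUc]
    calc G (insert x z) * (U.card * ((p - B.card).descFactorial z.card : ℝ))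
        = (U.card * G (insert x z)) * ((p - B.card).descFactorial z.card : ℝ) := by ring
      _ = (G z * ((p - B.card).descFactorial z.card : ℝ)) * ((p - 1 - j - z.card : ℕ) : ℝ) := by
        rw [hrec]; ring
      _ = _ := by rw [ih]; ring

theorem expect_apply_eq {p : ℕ} (k j : Fin p) :
    (𝔼 π : Equiv.Perm (Fin p), if π k = j then (1 : ℝ) else 0) = 1 / p := by
  have hsym : ∀ k', (𝔼 π : Equiv.Perm (Fin p), if π k' = j then (1 : ℝ) else 0) =
      𝔼 π : Equiv.Perm (Fin p), if π k = j then (1 : ℝ) else 0 := fun k' =>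
    Fintype.expect_equiv (Equiv.mulRight (Equiv.swap k k')) _ _ fun π => by simp
  have hp : (p : ℝ) ≠ 0 := by have := k.pos; positivity
  rw [eq_div_iff hp, mul_comm]
  calc _ = ∑ k' : Fin p, 𝔼 π : Equiv.Perm (Fin p), (if π k' = j then (1 : ℝ) else 0) := by
        rw [Finset.sum_congr rfl fun k' _ => hsym k']; simp
    _ = 𝔼 π : Equiv.Perm (Fin p), ∑ k' : Fin p, (if π k' = j then (1 : ℝ) else 0) :=
        (Finset.expect_sum_comm _ _ _).symm
    _ = 𝔼 π : Equiv.Perm (Fin p), (1 : ℝ) := by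
        refine Finset.expect_congr rfl fun π _ => ?_
        simp_rw [← Equiv.eq_symm_apply]
        simp
    _ = 1 := Fintype.expect_one

theorem expect_apply_eq_mul_lt {p : ℕ} (k k' j : Fin p) (hk : k' ≠ k) :
    (𝔼 π : Equiv.Perm (Fin p), (if π k = j then (1 : ℝ) else 0) * if π k' < π k then 1 else 0) =
      j / (p * ((p : ℝ) - 1)) := by
  have hsym : ∀ x ∈ Finset.univ.erase k, (𝔼 π : Equiv.Perm (Fin p),
      (if π k = j then (1 : ℝ) else 0) * if π x < π k then 1 else 0) =
      𝔼 π : Equiv.Perm (Fin p), (if π k = j then (1 : ℝ) else 0) * if π k' < π k then 1 else 0 :=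
    fun x hx =>
    Fintype.expect_equiv (Equiv.mulRight (Equiv.swap k' x)) _ _ fun π => by
      simp [Equiv.swap_apply_of_ne_of_ne hk.symm (Finset.ne_of_mem_erase hx).symm]
  have hp : 1 < p := by
    by_contra h
    exact hk (Fin.ext (by omega))
  have hp1 : (1 : ℝ) < p := by exact_mod_cast hp
  have hp' : (p : ℝ) - 1 ≠ 0 := by linarith
  have hp0 : (p : ℝ) ≠ 0 := by linarith
  have key : ((p : ℝ) - 1) * (𝔼 π : Equiv.Perm (Fin p),
      (if π k = j then (1 : ℝ) else 0) * if π k' < π k then 1 else 0) = j / p := by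
    calc _ = ∑ x ∈ Finset.univ.erase k, 𝔼 π : Equiv.Perm (Fin p),
          (if π k = j then (1 : ℝ) else 0) * (if π x < π k then 1 else 0) := by
          rw [Finset.sum_congr rfl hsym, Finset.sum_const, nsmul_eq_mul,
            Finset.card_erase_of_mem (Finset.mem_univ _), Finset.card_univ, Fintype.card_fin,
            Nat.cast_sub hp.le, Nat.cast_one]
      _ = 𝔼 π : Equiv.Perm (Fin p), ∑ x ∈ Finset.univ.erase k,
          (if π k = j then (1 : ℝ) else 0) * (if π x < π k then 1 else 0) :=
          (Finset.expect_sum_comm _ _ _).symm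
      _ = 𝔼 π : Equiv.Perm (Fin p), (if π k = j then (1 : ℝ) else 0) * j := by
          refine Finset.expect_congr rfl fun π _ => ?_
          rw [← Finset.mul_sum]
          split_ifs with h
          · rw [Finset.sum_boole, h]
            congr 2
            have : (Finset.univ.erase k).filter (fun x => π x < j) =
                (Finset.Iio j).map π.symm.toEmbedding := by
              ext y
              simp only [Finset.mem_filter, Finset.mem_erase, Finset.mem_univ, and_true,
                Finset.mem_map_equiv, Equiv.symm_symm, Finset.mem_Iio, and_iff_right_iff_imp]
              rintro hy rfl
              exact absurd h hy.ne
            rw [this, Finset.card_map, Fin.card_Iio]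
          · simp
      _ = j / p := by
          rw [← Finset.expect_mul, expect_apply_eq]; ring
  field_simp at key ⊢
  linarith

/-- For `k ∈ z`, the indicator of the event that `k` comes before all other variables of `z`. -/
noncomputable def firstInd {p : ℕ} (z : Finset (Fin p)) (k : Fin p) (π : Equiv.Perm (Fin p)) : ℝ :=
  ∏ x ∈ z.erase k, if π k < π x then 1 else 0

theorem expect_firstInd_mul {p : ℕ} (z : Finset (Fin p)) {k : Fin p} (hk : k ∈ z) (g : ℕ → ℝ) :
    𝔼 π, firstInd z k π * g (π k) =
      (∑ j ∈ Finset.range p, g j * hashProb p z.card j) / p := by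
  classical
  have hcard : z.card ≤ p := by simpa using Finset.card_le_univ z
  have hz0 : 0 < z.card := Finset.card_pos.2 ⟨k, hk⟩
  have hdesc : ((p - 1).descFactorial (z.card - 1) : ℝ) ≠ 0 := by
    rw [Nat.cast_ne_zero, Ne, Nat.descFactorial_eq_zero_iff_lt]; omega
  have h1 : ∀ j : Fin p, (𝔼 π : Equiv.Perm (Fin p), (if π k = j then (1 : ℝ) else 0) *
      ∏ x ∈ z.erase k, (if j < π x then 1 else 0)) = hashProb p z.card j / p := fun j => by
    have := expect_mul_prod_lt {k} (fun π => if π k = j then (1 : ℝ) else 0) j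
      (fun x hx y hy π => by
        rw [Finset.mem_singleton] at hx hy
        simp [Equiv.swap_apply_of_ne_of_ne (Ne.symm hx) (Ne.symm hy)])
      (fun π h b hb => by
        rw [Finset.mem_singleton] at hb
        subst hb
        simpa using (show π b = j by by_contra h'; simp [h'] at h).le)
      (z.erase k) (by simp)
    rw [expect_apply_eq, Finset.card_erase_of_mem hk, Finset.card_singleton] at this
    rw [hashProb, if_pos j.2, eq_div_of_mul_eq hdesc this]
    ring
  calc _ = 𝔼 π : Equiv.Perm (Fin p), ∑ j : Fin p, g j * ((if π k = j then (1 : ℝ) else 0) *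
      ∏ x ∈ z.erase k, (if j < π x then 1 else 0)) := by
        refine Finset.expect_congr rfl fun π _ => ?_
        rw [Finset.sum_eq_single (π k) (fun j _ hj => by simp [hj.symm]) (by simp), firstInd]
        simp [mul_comm]
    _ = _ := by
        rw [Finset.expect_sum_comm, Finset.sum_div, Finset.sum_range]
        refine Finset.sum_congr rfl fun j _ => ?_
        rw [← Finset.mul_expect, h1, mul_div_assoc]

/-- Given that `k'` comes before `π k = j`, the other variables of `z` compete for the later
positions with `p - 2` variables instead of `p - 1`, which is why `hashProb (p - 1)` appears at
`j - 1`. -/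
theorem expect_firstInd_mul_lt {p : ℕ} (z : Finset (Fin p)) {k k' : Fin p} (hk : k ∈ z)
    (hk' : k' ∉ z) (g : ℕ → ℝ) :
    𝔼 π, firstInd z k π * ((if π k' < π k then 1 else 0) * g (π k)) =
      (∑ j ∈ Finset.range (p - 1), g (j + 1) * ((j + 1) * hashProb (p - 1) z.card j)) /
        (p * ((p : ℝ) - 1)) := by
  classical
  have hne : k' ≠ k := by rintro rfl; exact hk' hk
  have hcard : z.card + 1 ≤ p := by
    rw [← Finset.card_insert_of_notMem hk']
    simpa using Finset.card_le_univ (insert k' z)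
  have hz0 : 0 < z.card := Finset.card_pos.2 ⟨k, hk⟩
  have hdesc : ((p - 2).descFactorial (z.card - 1) : ℝ) ≠ 0 := by
    rw [Nat.cast_ne_zero, Ne, Nat.descFactorial_eq_zero_iff_lt]; omega
  have h1 : ∀ j : Fin p, (𝔼 π : Equiv.Perm (Fin p), ((if π k = j then (1 : ℝ) else 0) *
      if π k' < π k then 1 else 0) * ∏ x ∈ z.erase k, (if j < π x then 1 else 0)) =
      j * (((p - 1 - j).descFactorial (z.card - 1) : ℝ) /
        ((p - 2).descFactorial (z.card - 1) : ℝ)) / (p * ((p : ℝ) - 1)) := fun j => by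
    have := expect_mul_prod_lt {k, k'} (fun π => (if π k = j then (1 : ℝ) else 0) *
      if π k' < π k then 1 else 0) j
      (fun x hx y hy π => by
        simp only [Finset.mem_insert, Finset.mem_singleton, not_or] at hx hy
        simp [Equiv.swap_apply_of_ne_of_ne (Ne.symm hx.1) (Ne.symm hy.1),
          Equiv.swap_apply_of_ne_of_ne (Ne.symm hx.2) (Ne.symm hy.2)])
      (fun π h b hb => by
        have e1 : π k = j := by by_contra h'; simp [h'] at h
        have e2 : π k' < π k := by by_contra h'; simp [h'] at h
        simp only [Finset.mem_insert, Finset.mem_singleton] at hb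
        rcases hb with rfl | rfl
        · exact e1.le
        · exact (e1 ▸ e2).le)
      (z.erase k) (by
        rw [Finset.disjoint_right]
        intro a ha
        simp only [Finset.mem_insert, Finset.mem_singleton] at ha
        rcases ha with rfl | rfl
        · simp
        · simp [hk'])
    rw [expect_apply_eq_mul_lt k k' j hne, Finset.card_erase_of_mem hk,
      Finset.card_pair hne.symm] at this
    rw [eq_div_of_mul_eq hdesc this]
    ring
  calc _ = 𝔼 π : Equiv.Perm (Fin p), ∑ j : Fin p, g j * (((if π k = j then (1 : ℝ) else 0) *
      (if π k' < π k then 1 else 0)) * ∏ x ∈ z.erase k, (if j < π x then 1 else 0)) := by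
        refine Finset.expect_congr rfl fun π _ => ?_
        rw [Finset.sum_eq_single (π k) (fun j _ hj => by simp [hj.symm]) (by simp), firstInd]
        simp only [if_true]
        ring
    _ = _ := by
        rw [Finset.expect_sum_comm]
        set F : ℕ → ℝ := fun j => g j * (j * (((p - 1 - j).descFactorial (z.card - 1) : ℝ) /
          ((p - 2).descFactorial (z.card - 1) : ℝ)) / (p * ((p : ℝ) - 1))) with hF
        have e : ∀ j : Fin p, 𝔼 π : Equiv.Perm (Fin p), g j * (((if π k = j then (1 : ℝ) else 0) *
            (if π k' < π k then 1 else 0)) * ∏ x ∈ z.erase k, (if j < π x then 1 else 0)) =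
            F j := fun j => by
          rw [← Finset.mul_expect, h1]
        rw [Finset.sum_congr rfl fun j _ => e j, Fin.sum_univ_eq_sum_range F, hF]
        obtain ⟨m, rfl⟩ : ∃ m, p = m + 1 := ⟨p - 1, by omega⟩
        rw [Finset.sum_range_succ', Nat.add_sub_cancel, Finset.sum_div]
        simp only [Nat.cast_zero, zero_mul, zero_div, mul_zero, add_zero]
        refine Finset.sum_congr rfl fun j hj => ?_
        have hj := Finset.mem_range.1 hj
        have e1 : m - (j + 1) = m - 1 - j := by omega
        have e2 : m + 1 - 2 = m - 1 := by omega
        rw [hashProb, if_pos hj, e1, e2]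
        push_cast
        ring

/-! ### Moments of the oracle coefficients -/
theorem sqNorm_nonneg {m : ℕ} (v : Fin m → ℝ) : 0 ≤ sqNorm v :=
  Finset.sum_nonneg fun _ _ => sq_nonneg _

/-- The quantity `(2 - q/p) q` that governs the second moments of the oracle coefficients. -/
noncomputable def hashDim (p q : ℕ) : ℝ := (2 - (q : ℝ) / p) * q

theorem cast_le_hashDim {p q : ℕ} (hqp : q ≤ p) : (q : ℝ) ≤ hashDim p q := by
  have : (q : ℝ) / p ≤ 1 := div_le_one_of_le₀ (by exact_mod_cast hqp) (by positivity)
  unfold hashDim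
  nlinarith [show (0 : ℝ) ≤ q by positivity]

theorem one_le_hashDim {p q : ℕ} (hq : 1 ≤ q) (hqp : q ≤ p) : 1 ≤ hashDim p q :=
  le_trans (by exact_mod_cast hq) (cast_le_hashDim hqp)

/-- The weight of a main effect whose variable sits at position `j`; it is proportional to the
conditional probability of being hashed and normalised so that the oracle is unbiased. -/
noncomputable def mainWeight (p q j : ℕ) : ℝ :=
  p / (∑ i ∈ Finset.range p, hashProb p q i ^ 2) * hashProb p q j

/-- The weight of an interaction whose first variable sits at position `j`. It multiplies the event
that the second variable comes earlier, and by the junk value `x / 0 = 0` it vanishes when `q = p`,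
where no interaction is active. -/
noncomputable def interWeight (p q j : ℕ) : ℝ :=
  p * ((p : ℝ) - 1) / (∑ i ∈ Finset.range (p - 1), ((i : ℝ) + 1) * hashProb (p - 1) q i ^ 2) *
    hashProb (p - 1) q (j - 1)

theorem sum_hashProb_sq_pos {p q : ℕ} (hq : 1 ≤ q) (hqp : q ≤ p) :
    0 < ∑ i ∈ Finset.range p, hashProb p q i ^ 2 := by
  refine Finset.sum_pos' (fun _ _ => sq_nonneg _) ⟨0, Finset.mem_range.2 (by omega), ?_⟩
  rw [hashProb_zero hq hqp]; norm_num

theorem sum_succ_mul_hashProb_sq_pos {p q : ℕ} (hq : 1 ≤ q) (hqp : q ≤ p) :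
    0 < ∑ i ∈ Finset.range p, ((i : ℝ) + 1) * hashProb p q i ^ 2 := by
  refine Finset.sum_pos' (fun _ _ => by positivity) ⟨0, Finset.mem_range.2 (by omega), ?_⟩
  rw [hashProb_zero hq hqp]; norm_num

theorem mainScale_le {p q : ℕ} (hq : 1 ≤ q) (hqp : q ≤ p) :
    p / (∑ i ∈ Finset.range p, hashProb p q i ^ 2) ≤ hashDim p q := by
  rw [div_le_iff₀ (sum_hashProb_sq_pos hq hqp)]
  exact le_sum_hashProb_sq hq hqp

theorem interScale_le {p q : ℕ} (hq : 1 ≤ q) (hqp : q ≤ p) :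
    p * ((p : ℝ) - 1) / (∑ i ∈ Finset.range (p - 1), ((i : ℝ) + 1) * hashProb (p - 1) q i ^ 2) ≤
      2 * hashDim p q ^ 2 := by
  have hA := cast_le_hashDim hqp
  have hq0 : (1 : ℝ) ≤ q := by exact_mod_cast hq
  rcases hqp.lt_or_eq with h | rfl
  · have hle : q ≤ p - 1 := by omega
    rw [div_le_iff₀ (sum_succ_mul_hashProb_sq_pos hq hle)]
    have h1 := le_sum_succ_mul_hashProb_sq hq hle
    have hc : ((p - 1 : ℕ) : ℝ) = p - 1 := by rw [Nat.cast_sub (by omega), Nat.cast_one]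
    have hp1 : (0 : ℝ) < p - 1 := by rw [← hc]; exact_mod_cast (show 0 < p - 1 by omega)
    rw [hc] at h1
    set T := ∑ i ∈ Finset.range (p - 1), ((i : ℝ) + 1) * hashProb (p - 1) q i ^ 2
    have hT : 0 < T := sum_succ_mul_hashProb_sq_pos hq hle
    have h2 : (2 - (q : ℝ) / (p - 1)) * q ≤ hashDim p q := by
      unfold hashDim
      gcongr
      linarith
    calc p * ((p : ℝ) - 1) = (p - 1 + 1) * (p - 1) := by ring
      _ ≤ 2 * q * ((2 - (q : ℝ) / (p - 1)) * q) * T := h1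
      _ ≤ 2 * hashDim p q * hashDim p q * T := by
          have h3 : (q : ℝ) ≤ (2 - (q : ℝ) / (p - 1)) * q := by
            simpa [hashDim, hc] using cast_le_hashDim hle
          have h4 : (0 : ℝ) ≤ hashDim p q := by linarith
          gcongr
          linarith
      _ = _ := by ring
  · have : ∀ i, hashProb (q - 1) q i = 0 := fun i => by
      unfold hashProb
      split_ifs
      · rw [(Nat.descFactorial_eq_zero_iff_lt (n := q - 1 - 1 - i)).2 (by omega)]; simp
      · rfl
    simp only [this]
    simp only [ne_eq, OfNat.ofNat_ne_zero, not_false_eq_true, zero_pow, mul_zero,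
      Finset.sum_const_zero, div_zero]
    positivity

theorem interScale_nonneg (p q : ℕ) (hp : 1 ≤ p) :
    0 ≤ p * ((p : ℝ) - 1) /
      (∑ i ∈ Finset.range (p - 1), ((i : ℝ) + 1) * hashProb (p - 1) q i ^ 2) := by
  have : (0 : ℝ) ≤ (p : ℝ) - 1 := by simpa using hp
  exact div_nonneg (by positivity) (Finset.sum_nonneg fun i _ => by positivity)

theorem mainWeight_nonneg (p q j : ℕ) : 0 ≤ mainWeight p q j :=
  mul_nonneg (div_nonneg (by positivity) (Finset.sum_nonneg fun _ _ => sq_nonneg _))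
    (hashProb_nonneg _ _ _)

theorem interWeight_nonneg {p : ℕ} (hp : 1 ≤ p) (q j : ℕ) : 0 ≤ interWeight p q j :=
  mul_nonneg (interScale_nonneg p q hp) (hashProb_nonneg _ _ _)

theorem mainWeight_le {p q : ℕ} (hq : 1 ≤ q) (hqp : q ≤ p) (j : ℕ) :
    mainWeight p q j ≤ hashDim p q := by
  refine le_trans (mul_le_of_le_one_right ?_ (hashProb_le_one _ _ _)) (mainScale_le hq hqp)
  exact div_nonneg (by positivity) (sum_hashProb_sq_pos hq hqp).le

theorem interWeight_le {p q : ℕ} (hq : 1 ≤ q) (hqp : q ≤ p) (j : ℕ) :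
    interWeight p q j ≤ 2 * hashDim p q ^ 2 :=
  le_trans (mul_le_of_le_one_right (interScale_nonneg p q (by omega)) (hashProb_le_one _ _ _))
    (interScale_le hq hqp)

theorem expect_firstInd_mul_mainWeight {p q : ℕ} {z : Finset (Fin p)} (hz : z.card = q)
    {k : Fin p} (hk : k ∈ z) : 𝔼 π, firstInd z k π * mainWeight p q (π k) = 1 := by
  have hq : 1 ≤ q := hz ▸ Finset.card_pos.2 ⟨k, hk⟩
  have hqp : q ≤ p := by rw [← hz]; simpa using Finset.card_le_univ z
  have hs := (sum_hashProb_sq_pos hq hqp).ne'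
  have hp : (p : ℝ) ≠ 0 := by have := k.pos; positivity
  rw [expect_firstInd_mul z hk, hz]
  unfold mainWeight
  simp_rw [mul_assoc, ← sq]
  rw [← Finset.mul_sum]
  field_simp

theorem expect_firstInd_mul_interWeight {p q : ℕ} {z : Finset (Fin p)} (hz : z.card = q)
    {k k' : Fin p} (hk : k ∈ z) (hk' : k' ∉ z) :
    𝔼 π, firstInd z k π * ((if π k' < π k then 1 else 0) * interWeight p q (π k)) = 1 := by
  have hq : 1 ≤ q := hz ▸ Finset.card_pos.2 ⟨k, hk⟩
  have hqp : q + 1 ≤ p := by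
    rw [← hz, ← Finset.card_insert_of_notMem hk']
    simpa using Finset.card_le_univ (insert k' z)
  have hs := (sum_succ_mul_hashProb_sq_pos hq (Nat.le_sub_of_add_le hqp)).ne'
  have hp : (p : ℝ) ≠ 0 := by have := k.pos; positivity
  have hp1 : (p : ℝ) - 1 ≠ 0 := by
    have : (2 : ℝ) ≤ p := by exact_mod_cast (show 2 ≤ p by omega)
    linarith
  rw [expect_firstInd_mul_lt z hk hk', hz]
  unfold interWeight
  simp only [Nat.add_sub_cancel]
  set T := ∑ i ∈ Finset.range (p - 1), ((i : ℝ) + 1) * hashProb (p - 1) q i ^ 2 with hT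
  have : ∑ j ∈ Finset.range (p - 1), p * ((p : ℝ) - 1) / T * hashProb (p - 1) q j *
      ((j + 1) * hashProb (p - 1) q j) = p * ((p : ℝ) - 1) / T * T := by
    conv_rhs => rw [hT, Finset.mul_sum]
    exact Finset.sum_congr rfl fun j _ => by ring
  rw [this]
  field_simp

theorem hashProb_one {p j : ℕ} (hj : j < p) : hashProb p 1 j = 1 := by simp [hashProb, hj]

theorem expect_mainWeight_sq_le {p q : ℕ} (hq : 1 ≤ q) (hqp : q ≤ p) (k : Fin p) :
    𝔼 π : Equiv.Perm (Fin p), mainWeight p q (π k) ^ 2 ≤ hashDim p q := by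
  have h := expect_firstInd_mul {k} (Finset.mem_singleton_self k) fun j => mainWeight p q j ^ 2
  simp only [firstInd, Finset.erase_singleton, Finset.prod_empty, one_mul,
    Finset.card_singleton] at h
  have hs := (sum_hashProb_sq_pos hq hqp).ne'
  have hp : (p : ℝ) ≠ 0 := by have := k.pos; positivity
  rw [h]
  refine le_trans (le_of_eq ?_) (mainScale_le hq hqp)
  rw [Finset.sum_congr rfl fun j hj => by rw [hashProb_one (Finset.mem_range.1 hj), mul_one]]
  unfold mainWeight
  simp_rw [mul_pow]
  rw [← Finset.mul_sum]
  field_simp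

theorem expect_interWeight_sq_le {p q : ℕ} (hq : 1 ≤ q) (hqp : q ≤ p) (k k' : Fin p) :
    𝔼 π : Equiv.Perm (Fin p), (if π k' < π k then 1 else 0) * interWeight p q (π k) ^ 2 ≤
      2 * hashDim p q ^ 2 := by
  by_cases hk : k' = k
  · subst hk
    simp only [lt_irrefl, if_false, zero_mul, Finset.expect_const_zero]
    positivity
  have h := expect_firstInd_mul_lt {k} (Finset.mem_singleton_self k)
    (by simpa using hk) fun j => interWeight p q j ^ 2
  simp only [firstInd, Finset.erase_singleton, Finset.prod_empty, one_mul,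
    Finset.card_singleton] at h
  rw [h]
  refine le_trans (le_of_eq ?_) (interScale_le hq hqp)
  rw [Finset.sum_congr rfl fun j hj => by rw [hashProb_one (Finset.mem_range.1 hj), mul_one]]
  unfold interWeight
  simp only [Nat.add_sub_cancel]
  set T := ∑ i ∈ Finset.range (p - 1), ((i : ℝ) + 1) * hashProb (p - 1) q i ^ 2 with hT
  have : ∑ j ∈ Finset.range (p - 1), (p * ((p : ℝ) - 1) / T * hashProb (p - 1) q j) ^ 2 *
      ((j : ℝ) + 1) = (p * ((p : ℝ) - 1) / T) ^ 2 * T := by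
    conv_rhs => rw [hT, Finset.mul_sum]
    exact Finset.sum_congr rfl fun j _ => by ring
  rw [this]
  have hp1 : (p : ℝ) - 1 ≠ 0 := by
    have : 2 ≤ p := by
      by_contra h'
      exact hk (Fin.ext (by omega))
    have : (2 : ℝ) ≤ p := by exact_mod_cast this
    linarith
  have hp : (p : ℝ) ≠ 0 := by have := k.pos; positivity
  by_cases hT0 : T = 0
  · simp [hT0]
  · field_simp

/-- The oracle coefficient of variable `k`, as a function of the permutation: given that `k` is
hashed, it estimates `θ k` plus the interactions of `k` with the inactive variables. An active
variable cannot precede the hashed one, so the event `π k' < π k` detects inactive `k'`. -/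
noncomputable def oracleCoef {p : ℕ} (q : ℕ) (θ : Fin p → ℝ) (Θ : Matrix (Fin p) (Fin p) ℝ)
    (π : Equiv.Perm (Fin p)) (k : Fin p) : ℝ :=
  θ k * mainWeight p q (π k) +
    ∑ k', Θ k k' * ((if π k' < π k then 1 else 0) * interWeight p q (π k))

theorem firstInd_mul_lt_of_mem {p : ℕ} {z : Finset (Fin p)} {k k' : Fin p} (hk' : k' ∈ z)
    (π : Equiv.Perm (Fin p)) : firstInd z k π * (if π k' < π k then 1 else 0) = 0 := by
  split_ifs with h
  · have : k' ≠ k := by rintro rfl; exact lt_irrefl _ h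
    rw [firstInd, Finset.prod_eq_zero (Finset.mem_erase.2 ⟨this, hk'⟩) (if_neg h.not_gt), zero_mul]
  · exact mul_zero _

theorem expect_firstInd_mul_oracleCoef {p q : ℕ} {z : Finset (Fin p)} (hz : z.card = q)
    {k : Fin p} (hk : k ∈ z) (θ : Fin p → ℝ) (Θ : Matrix (Fin p) (Fin p) ℝ) :
    𝔼 π, firstInd z k π * oracleCoef q θ Θ π k =
      θ k + ∑ k', (if k' ∈ z then 0 else 1) * Θ k k' := by
  have e1 : ∀ π, firstInd z k π * oracleCoef q θ Θ π k =
      θ k * (firstInd z k π * mainWeight p q (π k)) + ∑ k', Θ k k' *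
        (firstInd z k π * ((if π k' < π k then 1 else 0) * interWeight p q (π k))) := fun π => by
    rw [oracleCoef, mul_add, Finset.mul_sum]
    congr 1
    · ring
    · exact Finset.sum_congr rfl fun _ _ => by ring
  simp_rw [e1]
  rw [Finset.expect_add_distrib, ← Finset.mul_expect, expect_firstInd_mul_mainWeight hz hk,
    mul_one, Finset.expect_sum_comm]
  congr 1
  refine Finset.sum_congr rfl fun k' _ => ?_
  rw [← Finset.mul_expect]
  split_ifs with h
  · simp_rw [← mul_assoc, firstInd_mul_lt_of_mem h]
    simp
  · rw [expect_firstInd_mul_interWeight hz hk h]; ring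

/-- Minkowski's inequality, for sums of squares `a` and `b` with cross term `c`. -/
theorem add_two_mul_add_le {a b c K x y : ℝ} (hK : 0 ≤ K) (hx : 0 ≤ x) (hy : 0 ≤ y)
    (ha : a ≤ K * x ^ 2) (hb : b ≤ K * y ^ 2) (ha0 : 0 ≤ a) (hc : c ^ 2 ≤ a * b) :
    a + 2 * c + b ≤ K * (x + y) ^ 2 := by
  have h1 : c ^ 2 ≤ (K * x * y) ^ 2 := by
    calc c ^ 2 ≤ a * b := hc
      _ ≤ a * (K * y ^ 2) := mul_le_mul_of_nonneg_left hb ha0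
      _ ≤ (K * x ^ 2) * (K * y ^ 2) := mul_le_mul_of_nonneg_right ha (by positivity)
      _ = _ := by ring
  have h2 := abs_le_of_sq_le_sq' h1 (by positivity)
  nlinarith [h2.2]

/-- The size of the interaction part of the coefficients. -/
noncomputable def interSize {p : ℕ} (Θ : Matrix (Fin p) (Fin p) ℝ) : ℝ :=
  ∑ k, ∑ k₁, ∑ k₂, |Θ k k₁ * Θ k k₂|

theorem coefSize_eq {p : ℕ} (q : ℕ) (θ : Fin p → ℝ) (Θ : Matrix (Fin p) (Fin p) ℝ) :
    coefSize q θ Θ = √(sqNorm θ) + √(2 * hashDim p q * interSize Θ) := by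
  rw [coefSize, hashDim, interSize, mul_assoc 2]

theorem sq_sum_mul_ind_le {ι : Type*} [Fintype ι] (t : ι → ℝ) (P : ι → Prop) [DecidablePred P]
    (w : ℝ) : (∑ i, t i * ((if P i then 1 else 0) * w)) ^ 2 ≤
      ∑ i, ∑ j, |t i * t j| * ((if P i then 1 else 0) * w ^ 2) := by
  rw [sq, Finset.sum_mul_sum]
  refine Finset.sum_le_sum fun i _ => Finset.sum_le_sum fun j _ => ?_
  have h := le_abs_self (t i * t j)
  have h0 := abs_nonneg (t i * t j)
  split_ifs
  · calc _ = (t i * t j) * w ^ 2 := by ring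
      _ ≤ |t i * t j| * w ^ 2 := mul_le_mul_of_nonneg_right h (sq_nonneg w)
      _ = _ := by ring
  · simp only [zero_mul, mul_zero, one_mul]; positivity
  · simp
  · simp

theorem interSize_nonneg {p : ℕ} (Θ : Matrix (Fin p) (Fin p) ℝ) : 0 ≤ interSize Θ :=
  Finset.sum_nonneg fun _ _ => Finset.sum_nonneg fun _ _ => Finset.sum_nonneg fun _ _ =>
    abs_nonneg _

theorem expect_sum_oracleCoef_sq_le {p q : ℕ} (hq : 1 ≤ q) (hqp : q ≤ p) (θ : Fin p → ℝ)
    (Θ : Matrix (Fin p) (Fin p) ℝ) :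
    𝔼 π : Equiv.Perm (Fin p), ∑ k, oracleCoef q θ Θ π k ^ 2 ≤
      hashDim p q * coefSize q θ Θ ^ 2 := by
  set A := hashDim p q with hA
  have hA1 : 1 ≤ A := one_le_hashDim hq hqp
  set a : Equiv.Perm (Fin p) → Fin p → ℝ := fun π k => θ k * mainWeight p q (π k) with ha
  set b : Equiv.Perm (Fin p) → Fin p → ℝ := fun π k =>
    ∑ k', Θ k k' * ((if π k' < π k then 1 else 0) * interWeight p q (π k)) with hb
  have e1 : ∀ π, ∑ k, oracleCoef q θ Θ π k ^ 2 =
      ∑ k, a π k ^ 2 + 2 * ∑ k, a π k * b π k + ∑ k, b π k ^ 2 := fun π => by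
    rw [Finset.mul_sum, ← Finset.sum_add_distrib, ← Finset.sum_add_distrib]
    refine Finset.sum_congr rfl fun k _ => ?_
    simp only [oracleCoef, ha, hb]; ring
  have hSa : 𝔼 π, ∑ k, a π k ^ 2 ≤ A * √(sqNorm θ) ^ 2 := by
    rw [Real.sq_sqrt (sqNorm_nonneg θ), sqNorm, Finset.mul_sum,
      Finset.expect_sum_comm]
    refine Finset.sum_le_sum fun k _ => ?_
    simp_rw [ha, mul_pow]
    rw [← Finset.mul_expect, mul_comm]
    exact mul_le_mul_of_nonneg_right (expect_mainWeight_sq_le hq hqp k) (sq_nonneg _)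
  have hSb : 𝔼 π, ∑ k, b π k ^ 2 ≤ A * √(2 * A * interSize Θ) ^ 2 := by
    rw [Real.sq_sqrt (by have := interSize_nonneg Θ; positivity)]
    calc _ ≤ 𝔼 π : Equiv.Perm (Fin p), ∑ k, ∑ k₁, ∑ k₂, |Θ k k₁ * Θ k k₂| *
          ((if π k₁ < π k then 1 else 0) * interWeight p q (π k) ^ 2) :=
          Finset.expect_le_expect fun π _ => Finset.sum_le_sum fun k _ =>
            sq_sum_mul_ind_le _ _ _
      _ ≤ ∑ k, ∑ k₁, ∑ k₂, |Θ k k₁ * Θ k k₂| * (2 * A ^ 2) := by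
          simp_rw [Finset.expect_sum_comm, ← Finset.mul_expect]
          exact Finset.sum_le_sum fun k _ => Finset.sum_le_sum fun k₁ _ =>
            Finset.sum_le_sum fun k₂ _ => mul_le_mul_of_nonneg_left
              (expect_interWeight_sq_le hq hqp k k₁) (abs_nonneg _)
      _ = _ := by
          simp_rw [← Finset.sum_mul]; rw [interSize]; ring
  have hC : (𝔼 π, ∑ k, a π k * b π k) ^ 2 ≤ (𝔼 π, ∑ k, a π k ^ 2) * 𝔼 π, ∑ k, b π k ^ 2 := by
    refine sq_le_mul_of_forall_two_mul_le fun t => ?_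
    rw [Finset.mul_expect, Finset.mul_expect, ← Finset.expect_add_distrib]
    refine Finset.expect_le_expect fun π _ => ?_
    rw [Finset.mul_sum, Finset.mul_sum, ← Finset.sum_add_distrib]
    exact Finset.sum_le_sum fun k _ => by nlinarith [sq_nonneg (a π k - t * b π k)]
  simp_rw [e1]
  rw [Finset.expect_add_distrib, Finset.expect_add_distrib, ← Finset.mul_expect, coefSize_eq]
  exact add_two_mul_add_le (by linarith) (Real.sqrt_nonneg _) (Real.sqrt_nonneg _) hSa hSb
    (Finset.expect_nonneg fun π _ => Finset.sum_nonneg fun _ _ => sq_nonneg _) hC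

theorem sum_oracleCoef_sq_le {p q : ℕ} (hq : 1 ≤ q) (hqp : q ≤ p) (θ : Fin p → ℝ)
    (Θ : Matrix (Fin p) (Fin p) ℝ) (π : Equiv.Perm (Fin p)) :
    ∑ k, oracleCoef q θ Θ π k ^ 2 ≤ 2 * hashDim p q ^ 3 * coefSize q θ Θ ^ 2 := by
  set A := hashDim p q with hA
  have hA1 : 1 ≤ A := one_le_hashDim hq hqp
  have hp : 1 ≤ p := hq.trans hqp
  set a : Fin p → ℝ := fun k => θ k * mainWeight p q (π k) with ha
  set b : Fin p → ℝ := fun k =>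
    ∑ k', Θ k k' * ((if π k' < π k then 1 else 0) * interWeight p q (π k)) with hb
  have e1 : ∑ k, oracleCoef q θ Θ π k ^ 2 =
      ∑ k, a k ^ 2 + 2 * ∑ k, a k * b k + ∑ k, b k ^ 2 := by
    rw [Finset.mul_sum, ← Finset.sum_add_distrib, ← Finset.sum_add_distrib]
    refine Finset.sum_congr rfl fun k _ => ?_
    simp only [oracleCoef, ha, hb]; ring
  have hSa : ∑ k, a k ^ 2 ≤ 2 * A ^ 3 * √(sqNorm θ) ^ 2 := by
    rw [Real.sq_sqrt (sqNorm_nonneg θ), sqNorm, Finset.mul_sum]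
    refine Finset.sum_le_sum fun k _ => ?_
    have h1 := pow_le_pow_left₀ (mainWeight_nonneg p q (π k)) (mainWeight_le hq hqp (π k)) 2
    have h2 : A ^ 2 ≤ 2 * A ^ 3 := by nlinarith [sq_nonneg A]
    rw [ha, mul_pow, mul_comm]
    exact mul_le_mul_of_nonneg_right (h1.trans h2) (sq_nonneg _)
  have hSb : ∑ k, b k ^ 2 ≤ 2 * A ^ 3 * √(2 * A * interSize Θ) ^ 2 := by
    rw [Real.sq_sqrt (by have := interSize_nonneg Θ; positivity)]
    calc _ ≤ ∑ k, ∑ k₁, ∑ k₂, |Θ k k₁ * Θ k k₂| *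
          ((if π k₁ < π k then 1 else 0) * interWeight p q (π k) ^ 2) :=
          Finset.sum_le_sum fun k _ => sq_sum_mul_ind_le _ _ _
      _ ≤ ∑ k, ∑ k₁, ∑ k₂, |Θ k k₁ * Θ k k₂| * ((2 * A ^ 2) ^ 2) := by
          refine Finset.sum_le_sum fun k _ => Finset.sum_le_sum fun k₁ _ =>
            Finset.sum_le_sum fun k₂ _ => mul_le_mul_of_nonneg_left ?_ (abs_nonneg _)
          have h1 := pow_le_pow_left₀ (interWeight_nonneg hp q (π k))
            (interWeight_le hq hqp (π k)) 2
          split_ifs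
          · rwa [one_mul]
          · rw [zero_mul]; positivity
      _ = _ := by
          simp_rw [← Finset.sum_mul]; rw [interSize]; ring
  rw [e1, coefSize_eq]
  exact add_two_mul_add_le (by positivity) (Real.sqrt_nonneg _) (Real.sqrt_nonneg _) hSa hSb
    (Finset.sum_nonneg fun _ _ => sq_nonneg _) (Finset.sum_mul_sq_le_sq_mul_sq _ _ _)

/-! ### Random signs and hashed columns -/
theorem expect_sign_mul_sign {p : ℕ} (k k' : Fin p) :
    𝔼 ψ : Fin p → ℤˣ, ((ψ k : ℤ) : ℝ) * ((ψ k' : ℤ) : ℝ) = if k = k' then 1 else 0 := by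
  split_ifs with h
  · subst h
    have : ∀ ψ : Fin p → ℤˣ, ((ψ k : ℤ) : ℝ) * ((ψ k : ℤ) : ℝ) = 1 := fun ψ => by
      rw [← Int.cast_mul, Int.units_coe_mul_self, Int.cast_one]
    simp_rw [this]
    exact Fintype.expect_one
  · have key : 𝔼 ψ : Fin p → ℤˣ, ((ψ k : ℤ) : ℝ) * ((ψ k' : ℤ) : ℝ) =
        𝔼 ψ : Fin p → ℤˣ, -(((ψ k : ℤ) : ℝ) * ((ψ k' : ℤ) : ℝ)) := by
      refine Fintype.expect_equiv (Equiv.mulLeft (Pi.mulSingle k (-1))) _ _ fun ψ => ?_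
      simp [Pi.mulSingle_eq_of_ne (Ne.symm h)]
    rw [Finset.expect_neg_distrib] at key
    linarith

theorem expect_sign_mul_sum {p : ℕ} (h : Fin p) (a : Fin p → ℝ) :
    𝔼 ψ : Fin p → ℤˣ, ((ψ h : ℤ) : ℝ) * ∑ k, ((ψ k : ℤ) : ℝ) * a k = a h := by
  simp_rw [Finset.mul_sum, ← mul_assoc]
  rw [Finset.expect_sum_comm]
  simp_rw [← Finset.expect_mul, expect_sign_mul_sign]
  simp

theorem expect_sq_sum_sign_mul {p : ℕ} (a : Fin p → ℝ) :
    𝔼 ψ : Fin p → ℤˣ, (∑ k, ((ψ k : ℤ) : ℝ) * a k) ^ 2 = ∑ k, a k ^ 2 := by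
  have : ∀ ψ : Fin p → ℤˣ, (∑ k, ((ψ k : ℤ) : ℝ) * a k) ^ 2 =
      ∑ h, a h * (((ψ h : ℤ) : ℝ) * ∑ k, ((ψ k : ℤ) : ℝ) * a k) := fun ψ => by
    rw [sq, Finset.sum_mul]
    exact Finset.sum_congr rfl fun _ _ => by ring
  simp_rw [this]
  rw [Finset.expect_sum_comm]
  simp_rw [← Finset.mul_expect, expect_sign_mul_sum, sq]

theorem expect_units_int (f : ℤˣ → ℝ) : 𝔼 u, f u = (f 1 + f (-1)) / 2 := by
  rw [Fintype.expect_eq_sum_div_card]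
  simp [Finset.univ, Fintype.elems]

/-- Sub-Gaussian squares of Rademacher sums: one sign is integrated out at a time, by
`cosh y ≤ exp (y² / 2)`. -/
theorem expect_exp_sq_add_sum_sign_le {p : ℕ} (a : Fin p → ℝ) {τ : ℝ} (hτ : 0 ≤ τ)
    (h : 2 * τ * ∑ k, a k ^ 2 < 1) (x : ℝ) :
    𝔼 ψ : Fin p → ℤˣ, Real.exp (τ * (x + ∑ k, ((ψ k : ℤ) : ℝ) * a k) ^ 2) ≤
      Real.exp ((τ * x ^ 2 + τ * ∑ k, a k ^ 2) / (1 - 2 * τ * ∑ k, a k ^ 2)) := by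
  induction p generalizing x with
  | zero => simp
  | succ p ih =>
    set v := ∑ k : Fin p, a k.succ ^ 2 with hv
    have hsum : ∑ k, a k ^ 2 = a 0 ^ 2 + v := Fin.sum_univ_succ _
    rw [hsum] at h ⊢
    have hv0 : 0 ≤ v := Finset.sum_nonneg fun _ _ => sq_nonneg _
    set M := 1 - 2 * τ * v with hM
    set M' := 1 - 2 * τ * (a 0 ^ 2 + v) with hM'
    have hM'0 : 0 < M' := by linarith
    have ht : 0 ≤ τ * a 0 ^ 2 := by positivity
    have hMM : M' = M - 2 * (τ * a 0 ^ 2) := by rw [hM, hM']; ring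
    have hM0 : 0 < M := by linarith
    have hstep : ∀ y, 𝔼 ψ : Fin p → ℤˣ, Real.exp (τ * (y + ∑ k, ((ψ k : ℤ) : ℝ) * a k.succ) ^ 2) ≤
        Real.exp ((τ * y ^ 2 + τ * v) / M) := fun y =>
      ih (fun k => a k.succ) (by linarith) y
    calc 𝔼 ψ : Fin (p + 1) → ℤˣ, Real.exp (τ * (x + ∑ k, ((ψ k : ℤ) : ℝ) * a k) ^ 2)
        = 𝔼 c : ℤˣ × (Fin p → ℤˣ), Real.exp (τ * ((x + ((c.1 : ℤ) : ℝ) * a 0) +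
            ∑ k, ((c.2 k : ℤ) : ℝ) * a k.succ) ^ 2) := by
          refine (Fintype.expect_equiv (Fin.consEquiv fun _ => ℤˣ) _ _ fun c => ?_).symm
          rw [Fin.sum_univ_succ, ← add_assoc]
          simp
      _ = 𝔼 u : ℤˣ, 𝔼 ψ : Fin p → ℤˣ, Real.exp (τ * ((x + ((u : ℤ) : ℝ) * a 0) +
            ∑ k, ((ψ k : ℤ) : ℝ) * a k.succ) ^ 2) := by
          rw [← Finset.univ_product_univ, Finset.expect_product]
      _ ≤ 𝔼 u : ℤˣ, Real.exp ((τ * (x + ((u : ℤ) : ℝ) * a 0) ^ 2 + τ * v) / M) :=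
          Finset.expect_le_expect fun u _ => hstep _
      _ = Real.exp ((τ * x ^ 2 + τ * a 0 ^ 2 + τ * v) / M) * Real.cosh (2 * τ * x * a 0 / M) := by
          rw [expect_units_int, Real.cosh_eq, mul_div_assoc', mul_add, ← Real.exp_add,
            ← Real.exp_add]
          congr 3
          · simp; ring
          · simp; ring
      _ ≤ Real.exp ((τ * x ^ 2 + τ * a 0 ^ 2 + τ * v) / M) *
            Real.exp ((2 * τ * x * a 0 / M) ^ 2 / 2) :=
          mul_le_mul_of_nonneg_left (Real.cosh_le_exp_half_sq _) (Real.exp_nonneg _)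
      _ ≤ _ := by
          rw [← Real.exp_add, Real.exp_le_exp]
          set t := τ * a 0 ^ 2 with htdef
          have e1 : (τ * x ^ 2 + t + τ * v) / M + (2 * τ * x * a 0 / M) ^ 2 / 2 =
              τ * x ^ 2 * ((M + 2 * t) / M ^ 2) + (t + τ * v) / M := by
            rw [htdef]; field_simp; ring
          have e2 : (τ * x ^ 2 + τ * (a 0 ^ 2 + v)) / M' =
              τ * x ^ 2 * (1 / M') + (t + τ * v) / M' := by
            rw [htdef]; field_simp
          rw [e1, e2]
          have e3 : (M + 2 * t) / M ^ 2 ≤ 1 / M' := by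
            rw [div_le_div_iff₀ (by positivity) hM'0, hMM]
            nlinarith [sq_nonneg t]
          have e4 : (t + τ * v) / M ≤ (t + τ * v) / M' :=
            div_le_div_of_nonneg_left (by positivity) hM'0 (by linarith)
          have := mul_le_mul_of_nonneg_left e3 (show 0 ≤ τ * x ^ 2 by positivity)
          linarith

theorem exp_half_div_one_sub_le {h : ℝ} (h0 : 0 ≤ h) (h1 : h ≤ 1 / 4) :
    Real.exp (h / 2 / (1 - h)) ≤ 1 + h := by
  set t := h / 2 / (1 - h) with ht
  have hpos : 0 < 1 - h := by linarith
  have ht0 : 0 ≤ t := by positivity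
  have hth : t * (1 - h) = h / 2 := by rw [ht]; field_simp
  have ht1 : t ≤ 1 / 6 := by nlinarith
  have h2 : Real.exp t ≤ 1 / (1 - t) := by
    have := Real.add_one_le_exp (-t)
    rw [Real.exp_neg] at this
    rw [le_div_iff₀ (by linarith), ← le_inv_mul_iff₀ (Real.exp_pos t)]
    linarith
  refine h2.trans ?_
  rw [div_le_iff₀ (by linarith)]
  nlinarith

theorem expect_exp_sq_sum_sign_le {p : ℕ} (a : Fin p → ℝ) {τ : ℝ} (hτ : 0 ≤ τ)
    (h : 2 * τ * ∑ k, a k ^ 2 ≤ 1 / 4) :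
    𝔼 ψ : Fin p → ℤˣ, Real.exp (τ * (∑ k, ((ψ k : ℤ) : ℝ) * a k) ^ 2) ≤
      1 + 2 * τ * ∑ k, a k ^ 2 := by
  have h1 := expect_exp_sq_add_sum_sign_le a hτ (by linarith) 0
  simp only [zero_add] at h1
  refine h1.trans (le_trans (le_of_eq ?_) (exp_half_div_one_sub_le
    (by have := Finset.sum_nonneg fun k (_ : k ∈ Finset.univ) => sq_nonneg (a k); positivity) h))
  congr 1
  ring

theorem minHash_mem {p : ℕ} {z : Finset (Fin p)} (hz : z.Nonempty) (π : Equiv.Perm (Fin p)) :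
    minHash z hz π ∈ z := by
  have := Finset.min'_mem (z.image π) (hz.image π)
  obtain ⟨k, hk, h⟩ := Finset.mem_image.1 this
  rw [minHash, ← h]
  simpa using hk

theorem apply_minHash_le {p : ℕ} {z : Finset (Fin p)} (hz : z.Nonempty) (π : Equiv.Perm (Fin p))
    {x : Fin p} (hx : x ∈ z) : π (minHash z hz π) ≤ π x := by
  rw [minHash, Equiv.apply_symm_apply]
  exact Finset.min'_le _ _ (Finset.mem_image_of_mem π hx)

theorem firstInd_eq {p : ℕ} {z : Finset (Fin p)} (hz : z.Nonempty) {k : Fin p} (hk : k ∈ z)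
    (π : Equiv.Perm (Fin p)) : firstInd z k π = if minHash z hz π = k then 1 else 0 := by
  split_ifs with h
  · refine Finset.prod_eq_one fun x hx => if_pos ?_
    obtain ⟨hne, hxz⟩ := Finset.mem_erase.1 hx
    rw [← h] at hne ⊢
    exact lt_of_le_of_ne (apply_minHash_le hz π hxz) fun h' => hne (π.injective h').symm
  · refine Finset.prod_eq_zero (i := minHash z hz π)
      (Finset.mem_erase.2 ⟨h, minHash_mem hz π⟩) (if_neg (not_lt.2 (apply_minHash_le hz π hk)))

/-- The randomness behind one column of the hashed matrix. -/
abbrev ColumnSeed (p : ℕ) : Type := Equiv.Perm (Fin p) × (Fin p → ℤˣ)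

/-- The entry of a hashed column in a row `x` with support `z`. -/
noncomputable def hashEntry {p : ℕ} (x : Fin p → ℝ) (z : Finset (Fin p)) (hz : z.Nonempty)
    (c : ColumnSeed p) : ℝ :=
  ((c.2 (minHash z hz c.1) : ℤ) : ℝ) * x (minHash z hz c.1)

/-- The coefficient that the oracle attaches to a hashed column: a Rademacher sum of the oracle
coefficients of the variables. -/
noncomputable def oracleColumn {p : ℕ} (q : ℕ) (θ : Fin p → ℝ) (Θ : Matrix (Fin p) (Fin p) ℝ)
    (c : ColumnSeed p) : ℝ :=
  ∑ k, ((c.2 k : ℤ) : ℝ) * oracleCoef q θ Θ c.1 k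

theorem expect_columnSeed {p : ℕ} (f : ColumnSeed p → ℝ) :
    𝔼 c, f c = 𝔼 π, 𝔼 ψ, f (π, ψ) := by
  rw [← Finset.univ_product_univ, Finset.expect_product]

theorem expect_hashEntry_mul_oracleColumn {p q : ℕ} {z : Finset (Fin p)} (hzq : z.card = q)
    (hz : z.Nonempty) (x θ : Fin p → ℝ) (Θ : Matrix (Fin p) (Fin p) ℝ) :
    𝔼 c, hashEntry x z hz c * oracleColumn q θ Θ c =
      ∑ k ∈ z, x k * (θ k + ∑ k', (if k' ∈ z then 0 else 1) * Θ k k') := by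
  have e1 : ∀ π, 𝔼 ψ, hashEntry x z hz (π, ψ) * oracleColumn q θ Θ (π, ψ) =
      ∑ k ∈ z, x k * (firstInd z k π * oracleCoef q θ Θ π k) := fun π => by
    simp only [hashEntry, oracleColumn]
    set H := minHash z hz π with hH
    have e2 : ∀ ψ : Fin p → ℤˣ, ((ψ H : ℤ) : ℝ) * x H *
        ∑ k, ((ψ k : ℤ) : ℝ) * oracleCoef q θ Θ π k =
        x H * (((ψ H : ℤ) : ℝ) * ∑ k, ((ψ k : ℤ) : ℝ) * oracleCoef q θ Θ π k) := fun ψ => by ring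
    rw [Finset.expect_congr rfl fun ψ _ => e2 ψ, ← Finset.mul_expect, expect_sign_mul_sum]
    rw [Finset.sum_eq_single_of_mem H (minHash_mem hz π), firstInd_eq hz (minHash_mem hz π),
      if_pos rfl, one_mul]
    intro k hk hne
    rw [firstInd_eq hz hk, if_neg hne.symm]
    ring
  rw [expect_columnSeed]
  simp_rw [e1]
  rw [Finset.expect_sum_comm]
  refine Finset.sum_congr rfl fun k hk => ?_
  rw [← Finset.mul_expect, expect_firstInd_mul_oracleCoef hzq hk]

theorem hashEntry_sq_le {p : ℕ} {x : Fin p → ℝ} (hx : ∀ k, |x k| ≤ 1) {z : Finset (Fin p)}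
    (hz : z.Nonempty) (c : ColumnSeed p) : hashEntry x z hz c ^ 2 ≤ 1 := by
  have h1 : ((c.2 (minHash z hz c.1) : ℤ) : ℝ) ^ 2 = 1 := by
    rw [sq, ← Int.cast_mul, Int.units_coe_mul_self, Int.cast_one]
  rw [hashEntry, mul_pow, h1, one_mul, ← sq_abs]
  exact pow_le_one₀ (abs_nonneg _) (hx _)

theorem expect_oracleColumn_sq_le {p q : ℕ} (hq : 1 ≤ q) (hqp : q ≤ p) (θ : Fin p → ℝ)
    (Θ : Matrix (Fin p) (Fin p) ℝ) :
    𝔼 c, oracleColumn q θ Θ c ^ 2 ≤ hashDim p q * coefSize q θ Θ ^ 2 := by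
  rw [expect_columnSeed]
  simp_rw [oracleColumn, expect_sq_sum_sign_mul]
  exact expect_sum_oracleCoef_sq_le hq hqp θ Θ

theorem expect_exp_oracleColumn_sq_le {p q : ℕ} (hq : 1 ≤ q) (hqp : q ≤ p) (θ : Fin p → ℝ)
    (Θ : Matrix (Fin p) (Fin p) ℝ) (hℓ : 0 < coefSize q θ Θ) :
    𝔼 c, Real.exp (1 / (16 * hashDim p q ^ 3 * coefSize q θ Θ ^ 2) * oracleColumn q θ Θ c ^ 2) ≤
      1 + 1 / (8 * hashDim p q ^ 2) := by
  set A := hashDim p q with hA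
  set ℓ := coefSize q θ Θ with hℓdef
  have hA1 : 1 ≤ A := one_le_hashDim hq hqp
  set τ : ℝ := 1 / (16 * A ^ 3 * ℓ ^ 2) with hτ
  have hτ0 : 0 ≤ τ := by positivity
  have hW : ∀ π, 2 * τ * ∑ k, oracleCoef q θ Θ π k ^ 2 ≤ 1 / 4 := fun π => by
    calc _ ≤ 2 * τ * (2 * A ^ 3 * ℓ ^ 2) :=
          mul_le_mul_of_nonneg_left (sum_oracleCoef_sq_le hq hqp θ Θ π) (by positivity)
      _ = 1 / 4 := by rw [hτ]; field_simp; norm_num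
  rw [expect_columnSeed]
  simp_rw [oracleColumn]
  calc _ ≤ 𝔼 π, (1 + 2 * τ * ∑ k, oracleCoef q θ Θ π k ^ 2) :=
        Finset.expect_le_expect fun π _ => expect_exp_sq_sum_sign_le _ hτ0 (hW π)
    _ = 1 + 2 * τ * 𝔼 π, ∑ k, oracleCoef q θ Θ π k ^ 2 := by
        rw [Finset.expect_add_distrib, ← Finset.mul_expect, Fintype.expect_one]
    _ ≤ 1 + 2 * τ * (A * ℓ ^ 2) := by
        have := expect_sum_oracleCoef_sq_le hq hqp θ Θ
        gcongr
    _ = _ := by rw [hτ]; field_simp; ring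

/-! ### Independent columns -/
theorem expect_pi_prod {α : Type*} [Fintype α] {L : ℕ} (f : Fin L → α → ℝ) :
    𝔼 s : Fin L → α, ∏ l, f l (s l) = ∏ l, 𝔼 a, f l a := by
  classical
  simp_rw [Fintype.expect_eq_sum_div_card]
  rw [Finset.prod_div_distrib, Finset.prod_univ_sum, Fintype.piFinset_univ]
  simp

theorem expect_pi_apply {α : Type*} [Fintype α] [Nonempty α] {L : ℕ} (g : α → ℝ) (l : Fin L) :
    𝔼 s : Fin L → α, g (s l) = 𝔼 a, g a := by
  have h := expect_pi_prod (fun (i : Fin L) (a : α) => if i = l then g a else 1)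
  have e1 : ∀ i : Fin L, (𝔼 a : α, if i = l then g a else 1) = if i = l then 𝔼 a, g a else 1 := by
    intro i
    split_ifs
    · rfl
    · exact Fintype.expect_one
  simp_rw [e1] at h
  simpa using h

theorem expect_pi_sq_sum {α : Type*} [Fintype α] [Nonempty α] {L : ℕ} {g : α → ℝ}
    (hg : 𝔼 a, g a = 0) : 𝔼 s : Fin L → α, (∑ l, g (s l)) ^ 2 = L * 𝔼 a, g a ^ 2 := by
  have hpair : ∀ l l' : Fin L, 𝔼 s : Fin L → α, g (s l) * g (s l') =
      if l = l' then 𝔼 a, g a ^ 2 else 0 := fun l l' => by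
    split_ifs with h
    · subst h
      simp_rw [← sq]
      exact expect_pi_apply (fun a => g a ^ 2) l
    · have h1 := expect_pi_prod (fun (i : Fin L) (a : α) =>
        (if i = l then g a else 1) * (if i = l' then g a else 1))
      rw [Finset.prod_eq_zero (Finset.mem_univ l) (by simpa [h] using hg)] at h1
      simp_rw [Finset.prod_mul_distrib] at h1
      simpa using h1
  simp_rw [sq (∑ l, g (_ : α)), Finset.sum_mul_sum]
  rw [Finset.expect_sum_comm]
  simp_rw [Finset.expect_sum_comm, hpair]
  simp

theorem expect_exp_pi_sum {α : Type*} [Fintype α] {L : ℕ} (g : α → ℝ) :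
    𝔼 s : Fin L → α, Real.exp (∑ l, g (s l)) = (𝔼 a, Real.exp (g a)) ^ L := by
  simp_rw [Real.exp_sum]
  rw [expect_pi_prod (fun (_ : Fin L) a => Real.exp (g a))]
  simp

/-- The oracle fit is an average of `L` i.i.d. unbiased terms. -/
theorem expect_oracle_error_sq_le {p q L : ℕ} (hL : 1 ≤ L) {z : Finset (Fin p)} (hzq : z.card = q)
    (hz : z.Nonempty) {x : Fin p → ℝ} (hx : ∀ k, |x k| ≤ 1) (θ : Fin p → ℝ)
    (Θ : Matrix (Fin p) (Fin p) ℝ) :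
    𝔼 s : Fin L → ColumnSeed p,
      (∑ l, hashEntry x z hz (s l) * (oracleColumn q θ Θ (s l) / L) -
        ∑ k ∈ z, x k * (θ k + ∑ k', (if k' ∈ z then 0 else 1) * Θ k k')) ^ 2 ≤
      hashDim p q * coefSize q θ Θ ^ 2 / L := by
  have hq : 1 ≤ q := hzq ▸ Finset.card_pos.2 hz
  have hqp : q ≤ p := by rw [← hzq]; simpa using Finset.card_le_univ z
  have hL0 : (0 : ℝ) < L := by exact_mod_cast hL
  rw [← expect_hashEntry_mul_oracleColumn hzq hz]
  set Y : ColumnSeed p → ℝ := fun c => hashEntry x z hz c * oracleColumn q θ Θ c with hY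
  set f := 𝔼 c, Y c with hf
  set g : ColumnSeed p → ℝ := fun c => Y c - f with hg
  have hg0 : 𝔼 c, g c = 0 := by
    rw [hg, Finset.expect_sub_distrib, Fintype.expect_const, hf, sub_self]
  have e1 : ∀ s : Fin L → ColumnSeed p,
      (∑ l, hashEntry x z hz (s l) * (oracleColumn q θ Θ (s l) / L) - f) ^ 2 =
        (∑ l, g (s l)) ^ 2 * (1 / (L : ℝ) ^ 2) := fun s => by
    have : ∑ l, hashEntry x z hz (s l) * (oracleColumn q θ Θ (s l) / L) - f =
        (∑ l, g (s l)) / L := by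
      simp only [hg, hY, Finset.sum_sub_distrib, Finset.sum_const, Finset.card_univ,
        Fintype.card_fin, nsmul_eq_mul, sub_div, mul_div_assoc', ← Finset.sum_div]
      field_simp
    rw [this]; ring
  rw [Finset.expect_congr rfl fun s _ => e1 s, ← Finset.expect_mul, expect_pi_sq_sum hg0]
  have h1 : 𝔼 c, g c ^ 2 ≤ 𝔼 c, Y c ^ 2 := by
    have e2 : ∀ c, g c ^ 2 = Y c ^ 2 - 2 * f * Y c + f ^ 2 := fun c => by simp only [hg]; ring
    simp_rw [e2]
    rw [Finset.expect_add_distrib, Finset.expect_sub_distrib, ← Finset.mul_expect, ← hf,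
      Fintype.expect_const]
    nlinarith [sq_nonneg f]
  have h2 : 𝔼 c, Y c ^ 2 ≤ hashDim p q * coefSize q θ Θ ^ 2 := by
    refine le_trans (Finset.expect_le_expect fun c _ => ?_)
      (expect_oracleColumn_sq_le hq hqp θ Θ)
    simp only [hY, mul_pow]
    exact mul_le_of_le_one_left (sq_nonneg _) (hashEntry_sq_le hx hz c)
  calc _ = (𝔼 c, g c ^ 2) / L := by field_simp
    _ ≤ _ := by gcongr; exact h1.trans h2

theorem expect_sum_oracleColumn_sq_le {p q L : ℕ} (hq : 1 ≤ q) (hqp : q ≤ p) (θ : Fin p → ℝ)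
    (Θ : Matrix (Fin p) (Fin p) ℝ) :
    𝔼 s : Fin L → ColumnSeed p, ∑ l, oracleColumn q θ Θ (s l) ^ 2 ≤
      L * (hashDim p q * coefSize q θ Θ ^ 2) := by
  rw [Finset.expect_sum_comm]
  simp_rw [fun l : Fin L => expect_pi_apply (fun c => oracleColumn q θ Θ c ^ 2) l]
  simp only [Finset.sum_const, Finset.card_univ, Fintype.card_fin, nsmul_eq_mul]
  exact mul_le_mul_of_nonneg_left (expect_oracleColumn_sq_le hq hqp θ Θ) (by positivity)

theorem expect_exp_sum_oracleColumn_sq_le {p q L : ℕ} (hq : 1 ≤ q) (hqp : q ≤ p) (θ : Fin p → ℝ)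
    (Θ : Matrix (Fin p) (Fin p) ℝ) (hℓ : 0 < coefSize q θ Θ) :
    𝔼 s : Fin L → ColumnSeed p, Real.exp (1 / (16 * hashDim p q ^ 3 * coefSize q θ Θ ^ 2) *
        ∑ l, oracleColumn q θ Θ (s l) ^ 2) ≤ Real.exp (L / (8 * hashDim p q ^ 2)) := by
  simp_rw [Finset.mul_sum]
  rw [expect_exp_pi_sum (fun c => 1 / (16 * hashDim p q ^ 3 * coefSize q θ Θ ^ 2) *
    oracleColumn q θ Θ c ^ 2)]
  have h := expect_exp_oracleColumn_sq_le hq hqp θ Θ hℓ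
  have h2 := Real.add_one_le_exp (1 / (8 * hashDim p q ^ 2))
  calc _ ≤ Real.exp (1 / (8 * hashDim p q ^ 2)) ^ L :=
        pow_le_pow_left₀ (Finset.expect_nonneg fun _ _ => Real.exp_nonneg _) (by linarith) _
    _ = _ := by rw [← Real.exp_nat_mul]; congr 1; ring

/-- A tail bound read off an exponential moment: for large `s` by `x ≤ exp (s x) / (e s)`, for small
`s` because the right-hand side is close to one. -/
theorem expect_half_max_sqrt_sub_one_le {α : Type*} [Fintype α] [Nonempty α] {Z : α → ℝ}
    (hZ : ∀ a, 0 ≤ Z a) {s K t : ℝ} (hexp : 𝔼 a, Real.exp (s * (Z a - 1)) ≤ Real.exp (-K))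
    (hmean : 𝔼 a, Z a ≤ 1 / 2) (hs : 0 ≤ s) (hKs : K ≤ s) (htK : t ≤ K) :
    𝔼 a, 1 / 2 * max (√(Z a) - 1) 0 ≤ Real.exp (-t) := by
  have hroot : ∀ a, √(Z a) ^ 2 = Z a := fun a => Real.sq_sqrt (hZ a)
  rcases le_or_gt (1 / 10) s with h | h
  · refine le_trans (Finset.expect_le_expect fun a _ => ?_)
      (hexp.trans (Real.exp_le_exp.2 (neg_le_neg htK)))
    have h0 := Real.sqrt_nonneg (Z a)
    rcases le_total (√(Z a) - 1) 0 with h1 | h1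
    · rw [max_eq_right h1, mul_zero]; exact Real.exp_nonneg _
    · rw [max_eq_left h1]
      set x := Z a - 1 with hx
      have hx0 : 0 ≤ x := by have := hroot a; nlinarith
      have h2 : 1 / 2 * (√(Z a) - 1) ≤ 1 / 4 * x := by
        have := hroot a; nlinarith [sq_nonneg (√(Z a) - 1)]
      have h3 : Real.exp 1 * (s * x) ≤ Real.exp (s * x) := by
        have := Real.add_one_le_exp (s * x - 1)
        rw [Real.exp_sub, le_div_iff₀ (Real.exp_pos 1)] at this
        linarith
      have h4 := Real.exp_one_gt_d9
      have h5 : 1 / 4 * x ≤ Real.exp 1 * (s * x) := by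
        have : (1 : ℝ) / 4 ≤ Real.exp 1 * s := by nlinarith
        calc _ ≤ (Real.exp 1 * s) * x := mul_le_mul_of_nonneg_right this hx0
          _ = _ := by ring
      linarith
  · have h1 : 𝔼 a, 1 / 2 * max (√(Z a) - 1) 0 ≤ 𝔼 a, 1 / 8 * Z a := by
      refine Finset.expect_le_expect fun a _ => ?_
      rcases le_total (√(Z a) - 1) 0 with h1 | h1
      · rw [max_eq_right h1]; have := hZ a; linarith
      · rw [max_eq_left h1]
        nlinarith [hroot a, sq_nonneg (√(Z a) - 2)]
    rw [← Finset.mul_expect (f := Z)] at h1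
    have h2 := Real.add_one_le_exp (-t)
    linarith

/-- The normalised oracle leaves the unit ball only rarely. -/
theorem expect_half_max_oracle_norm_le {p q L : ℕ} (hq : 1 ≤ q) (hqp : q ≤ p) (hL : 1 ≤ L)
    (θ : Fin p → ℝ) (Θ : Matrix (Fin p) (Fin p) ℝ) (hℓ : 0 < coefSize q θ Θ) {η : ℝ}
    (hη : 0 < η) :
    𝔼 s : Fin L → ColumnSeed p, 1 / 2 * max (√((∑ l, oracleColumn q θ Θ (s l) ^ 2) /
      (2 * L * (1 + η) * (hashDim p q * coefSize q θ Θ ^ 2))) - 1) 0 ≤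
      Real.exp (-(L * η ^ 2 / (4 * hashDim p q ^ 2 * (3 + 2 * η)))) := by
  set A := hashDim p q with hA
  set ℓ := coefSize q θ Θ with hℓdef
  have hA1 : 1 ≤ A := one_le_hashDim hq hqp
  have hL0 : (0 : ℝ) < L := by exact_mod_cast hL
  refine expect_half_max_sqrt_sub_one_le (s := L * (1 + η) / (8 * A ^ 2))
    (K := L * η / (8 * A ^ 2))
    (fun s => div_nonneg (Finset.sum_nonneg fun _ _ => sq_nonneg _) (by positivity))
    ?_ ?_ (by positivity) (by gcongr; linarith) ?_
  · have e1 : ∀ s : Fin L → ColumnSeed p, Real.exp (L * (1 + η) / (8 * A ^ 2) *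
        ((∑ l, oracleColumn q θ Θ (s l) ^ 2) / (2 * L * (1 + η) * (A * ℓ ^ 2)) - 1)) =
        Real.exp (1 / (16 * A ^ 3 * ℓ ^ 2) * ∑ l, oracleColumn q θ Θ (s l) ^ 2) *
          Real.exp (-(L * (1 + η) / (8 * A ^ 2))) := fun s => by
      rw [← Real.exp_add]
      congr 1
      field_simp
      ring
    rw [Finset.expect_congr rfl fun s _ => e1 s, ← Finset.expect_mul]
    refine le_trans (mul_le_mul_of_nonneg_right
      (expect_exp_sum_oracleColumn_sq_le hq hqp θ Θ hℓ) (Real.exp_nonneg _)) (le_of_eq ?_)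
    rw [← Real.exp_add]
    congr 1
    rw [← hA]
    field_simp
    ring
  · rw [← Finset.expect_div, div_le_iff₀ (by positivity)]
    refine (expect_sum_oracleColumn_sq_le hq hqp θ Θ).trans ?_
    rw [← hA, ← hℓdef]
    nlinarith [show 0 < L * (A * ℓ ^ 2) * η by positivity]
  · rw [div_le_div_iff₀ (by positivity) (by positivity)]
    nlinarith [show 0 < L * η * A ^ 2 by positivity, show 0 < L * η ^ 2 * A ^ 2 by positivity]

/-! ### Centring, and the reduction of constrained ridge regression -/

/-- A vector with its mean subtracted. -/
noncomputable def center {m : ℕ} (v : Fin m → ℝ) : Fin m → ℝ := fun i => v i - mean v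

theorem mean_add {m : ℕ} (u v : Fin m → ℝ) : mean (u + v) = mean u + mean v := by
  simp [mean, Finset.sum_add_distrib, add_div]

theorem mean_sub {m : ℕ} (u v : Fin m → ℝ) : mean (u - v) = mean u - mean v := by
  simp [mean, Finset.sum_sub_distrib, sub_div]

theorem mean_smul {m : ℕ} (c : ℝ) (v : Fin m → ℝ) : mean (c • v) = c * mean v := by
  simp [mean, ← Finset.mul_sum, mul_div_assoc]

theorem mean_const {m : ℕ} (hm : 1 ≤ m) (c : ℝ) : mean (fun _ : Fin m => c) = c := by
  have : (m : ℝ) ≠ 0 := by positivity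
  simp [mean, this]

theorem center_add {m : ℕ} (u v : Fin m → ℝ) : center (u + v) = center u + center v := by
  ext i; simp [center, mean_add]; ring

theorem center_sub {m : ℕ} (u v : Fin m → ℝ) : center (u - v) = center u - center v := by
  ext i; simp [center, mean_sub]; ring

theorem center_smul {m : ℕ} (c : ℝ) (v : Fin m → ℝ) : center (c • v) = c • center v := by
  ext i; simp [center, mean_smul, mul_sub]

theorem center_const {m : ℕ} (hm : 1 ≤ m) (c : ℝ) : center (fun _ : Fin m => c) = 0 := by
  ext i; simp [center, mean_const hm]

theorem mean_center {m : ℕ} (hm : 1 ≤ m) (v : Fin m → ℝ) : mean (center v) = 0 := by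
  have : center v = v - fun _ => mean v := rfl
  rw [this, mean_sub, mean_const hm, sub_self]

theorem center_center {m : ℕ} (hm : 1 ≤ m) (v : Fin m → ℝ) : center (center v) = center v := by
  ext i
  change center v i - mean (center v) = center v i
  rw [mean_center hm, sub_zero]

theorem sqNorm_sub_const {m : ℕ} (hm : 1 ≤ m) (w : Fin m → ℝ) (c : ℝ) :
    sqNorm (fun i => w i - c) = sqNorm (center w) + m * (mean w - c) ^ 2 := by
  have hm0 : (m : ℝ) ≠ 0 := by positivity
  have h1 : ∑ i, center w i = 0 := by
    have := mean_center hm w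
    rw [mean, div_eq_zero_iff] at this
    tauto
  have h2 : ∀ i, (w i - c) ^ 2 =
      center w i ^ 2 + 2 * (mean w - c) * center w i + (mean w - c) ^ 2 := fun i => by
    simp only [center]; ring
  simp only [sqNorm, h2]
  rw [Finset.sum_add_distrib, Finset.sum_add_distrib, ← Finset.mul_sum, h1]
  simp

theorem sqNorm_eq_center {m : ℕ} (hm : 1 ≤ m) (w : Fin m → ℝ) :
    sqNorm w = sqNorm (center w) + m * mean w ^ 2 := by
  simpa using sqNorm_sub_const hm w 0

theorem sqNorm_center_le {m : ℕ} (hm : 1 ≤ m) (w : Fin m → ℝ) : sqNorm (center w) ≤ sqNorm w := by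
  rw [sqNorm_eq_center hm w]
  exact le_add_of_nonneg_right (by positivity)

theorem norm_toLp_sq {m : ℕ} (v : Fin m → ℝ) : ‖WithLp.toLp 2 v‖ ^ 2 = sqNorm v := by
  rw [EuclideanSpace.real_norm_sq_eq]; rfl

/-- Minimising over the intercept first reduces the constrained ridge problem to centred data. -/
theorem IsConstrainedRidge.center_le {n L : ℕ} (hn : 1 ≤ n) {Y : Fin n → ℝ}
    {S : Matrix (Fin n) (Fin L) ℝ} {r a : ℝ} {b : Fin L → ℝ} (h : IsConstrainedRidge Y S r a b) :
    a = mean (Y - S *ᵥ b) ∧ ∀ b', sqNorm b' ≤ r →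
      sqNorm (center (Y - S *ᵥ b)) ≤ sqNorm (center (Y - S *ᵥ b')) := by
  have hn0 : (0 : ℝ) < n := by exact_mod_cast hn
  have e : ∀ a' b', sqNorm (fun i => Y i - a' - (S *ᵥ b') i) =
      sqNorm (center (Y - S *ᵥ b')) + n * (mean (Y - S *ᵥ b') - a') ^ 2 := fun a' b' => by
    rw [← sqNorm_sub_const hn]
    congr 1
    ext i
    simp only [Pi.sub_apply]
    ring
  have key : ∀ b', sqNorm b' ≤ r → sqNorm (center (Y - S *ᵥ b)) +
      n * (mean (Y - S *ᵥ b) - a) ^ 2 ≤ sqNorm (center (Y - S *ᵥ b')) := fun b' hb' => by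
    have := h.2 (mean (Y - S *ᵥ b')) b' hb'
    rw [e, e] at this
    simpa using this
  constructor
  · have h1 := key b h.1
    have h2 : (mean (Y - S *ᵥ b) - a) ^ 2 ≤ 0 := by
      by_contra! h'
      have := mul_pos hn0 h'
      linarith
    have h3 : mean (Y - S *ᵥ b) - a = 0 := by nlinarith
    linarith
  · intro b' hb'
    have := key b' hb'
    have h4 : 0 ≤ n * (mean (Y - S *ᵥ b) - a) ^ 2 := by positivity
    linarith

/-- The centred fit as an operator on the unit ball of coefficients: `u ↦ Q S (√r u)`, with `Q` the
projection onto the vectors of mean zero. -/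
noncomputable def fitOp {n L : ℕ} (S : Matrix (Fin n) (Fin L) ℝ) (r : ℝ) :
    EuclideanSpace ℝ (Fin L) →L[ℝ] EuclideanSpace ℝ (Fin n) :=
  LinearMap.toContinuousLinearMap
    { toFun := fun u => WithLp.toLp 2 (center (S *ᵥ (√r • u.ofLp)))
      map_add' := fun u v => by
        simp [smul_add, Matrix.mulVec_add, center_add]
      map_smul' := fun c u => by
        simp only [WithLp.ofLp_smul, RingHom.id_apply]
        rw [smul_comm, Matrix.mulVec_smul, center_smul, WithLp.toLp_smul] }

theorem fitOp_apply {n L : ℕ} (S : Matrix (Fin n) (Fin L) ℝ) (r : ℝ)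
    (u : EuclideanSpace ℝ (Fin L)) :
    fitOp S r u = WithLp.toLp 2 (center (S *ᵥ (√r • u.ofLp))) := rfl

theorem exists_eq_sqrt_smul {L : ℕ} {r : ℝ} (hr : 0 ≤ r) {b : Fin L → ℝ} (hb : sqNorm b ≤ r) :
    ∃ u : EuclideanSpace ℝ (Fin L), ‖u‖ ≤ 1 ∧ √r • u.ofLp = b := by
  rcases hr.eq_or_lt with rfl | hr
  · refine ⟨0, by simp, ?_⟩
    ext i
    have h1 : b i ^ 2 ≤ sqNorm b :=
      Finset.single_le_sum (f := fun i => b i ^ 2) (fun _ _ => sq_nonneg _) (Finset.mem_univ i)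
    have h2 : b i = 0 := by nlinarith
    simp [h2]
  · have hr' : 0 < √r := Real.sqrt_pos.2 hr
    refine ⟨WithLp.toLp 2 ((√r)⁻¹ • b), ?_, ?_⟩
    · rw [← sq_le_one_iff₀ (norm_nonneg _), WithLp.toLp_smul, norm_smul, mul_pow, norm_toLp_sq,
        norm_inv, Real.norm_eq_abs, inv_pow, sq_abs, Real.sq_sqrt hr.le,
        inv_mul_le_iff₀ hr, mul_one]
      exact hb
    · simp [smul_smul, hr'.ne']

theorem sqNorm_sqrt_smul_le {L : ℕ} {r : ℝ} (hr : 0 ≤ r) {u : EuclideanSpace ℝ (Fin L)}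
    (hu : ‖u‖ ≤ 1) : sqNorm (√r • u.ofLp) ≤ r := by
  rw [← norm_toLp_sq, WithLp.toLp_smul, norm_smul, mul_pow, Real.norm_eq_abs, sq_abs,
    Real.sq_sqrt hr]
  exact mul_le_of_le_one_right hr ((sq_le_one_iff₀ (norm_nonneg _)).2 hu)

/-- The loss of any constrained ridge fit in terms of a selection `B` of minimisers of the centred
problem; the fitted values do not depend on the choice of the minimiser. -/
theorem fitLoss_eq {n L : ℕ} (hn : 1 ≤ n) (S : Matrix (Fin n) (Fin L) ℝ) {r : ℝ} (hr : 0 ≤ r)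
    (αs : ℝ) (f γ : Fin n → ℝ) (hγ : mean γ = 0)
    {B : EuclideanSpace ℝ (Fin n) → EuclideanSpace ℝ (Fin L)}
    (hB : ∀ v, ‖B v‖ ≤ 1 ∧ ∀ u, ‖u‖ ≤ 1 →
      ⟪v - fitOp S r (B v), fitOp S r u⟫ ≤ ⟪v - fitOp S r (B v), fitOp S r (B v)⟫)
    {e : Fin n → ℝ} {a : ℝ} {b : Fin L → ℝ}
    (h : IsConstrainedRidge (fun i => αs + f i + γ i + e i) S r a b) :
    fitLoss αs f S a b =
      ‖fitOp S r (B (WithLp.toLp 2 (center f) + WithLp.toLp 2 γ + WithLp.toLp 2 e)) -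
        WithLp.toLp 2 (center f)‖ ^ 2 + n * mean e ^ 2 := by
  obtain ⟨ha, hmin⟩ := h.center_le hn
  set Y : Fin n → ℝ := fun i => αs + f i + γ i + e i with hY
  have hYe : Y = (fun _ => αs) + f + γ + e := rfl
  have hYm : mean Y = αs + mean f + mean e := by
    rw [hYe, mean_add, mean_add, mean_add, mean_const hn, hγ]; ring
  have hYc : center Y = center f + center γ + center e := by
    rw [hYe, center_add, center_add, center_add, center_const hn, zero_add]
  obtain ⟨u, hu, hub⟩ := exists_eq_sqrt_smul hr h.1
  set v : Fin n → ℝ := center f + γ + e with hv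
  have hvc : center v = center Y := by
    rw [hv, hYc, center_add, center_add, center_center hn]
  have hdist : ∀ u' : EuclideanSpace ℝ (Fin L), ‖WithLp.toLp 2 v - fitOp S r u'‖ ^ 2 =
      sqNorm (center (Y - S *ᵥ (√r • u'.ofLp))) + n * mean v ^ 2 := fun u' => by
    rw [fitOp_apply, ← WithLp.toLp_sub, norm_toLp_sq, sqNorm_eq_center hn, center_sub, center_sub,
      hvc, center_center hn, mean_sub, mean_center hn, sub_zero]
  have hopt : ∀ u', ‖u'‖ ≤ 1 → ⟪WithLp.toLp 2 v - fitOp S r u, fitOp S r u'⟫ ≤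
      ⟪WithLp.toLp 2 v - fitOp S r u, fitOp S r u⟫ := fun u' hu' =>
    inner_le_of_isMin _ hu (fun w hw => by
      rw [← abs_norm, ← abs_norm (_ - fitOp S r w), ← sq_le_sq, hdist, hdist, hub]
      exact add_le_add_left (hmin _ (sqNorm_sqrt_smul_le hr hw)) _) hu'
  have hfit : fitOp S r u = fitOp S r (B (WithLp.toLp 2 v)) := by
    have := norm_sub_le_of_inner_le (fitOp S r) hu (hB (WithLp.toLp 2 v)).1 hopt
      (hB (WithLp.toLp 2 v)).2
    rw [sub_self, norm_zero] at this
    exact sub_eq_zero.1 (norm_eq_zero.1 (le_antisymm this (norm_nonneg _)))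
  rw [← WithLp.toLp_add, ← WithLp.toLp_add, ← hv, ← hfit, fitOp_apply, hub, ← WithLp.toLp_sub,
    norm_toLp_sq]
  have e1 : (fun i => αs + f i - a - (S *ᵥ b) i) =
      fun i => ((fun _ => αs) + f - S *ᵥ b : Fin n → ℝ) i - a := by
    ext i; simp only [Pi.add_apply, Pi.sub_apply]; ring
  have e2 : center ((fun _ => αs) + f - S *ᵥ b) = -(center (S *ᵥ b) - center f) := by
    rw [center_sub, center_add, center_const hn]; abel
  have e3 : sqNorm (-(center (S *ᵥ b) - center f)) = sqNorm (center (S *ᵥ b) - center f) := by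
    simp only [sqNorm, Pi.neg_apply, neg_sq]
  rw [fitLoss, e1, sqNorm_sub_const hn, e2, e3, ha, mean_sub, mean_add, mean_const hn, mean_sub,
    hYm]
  congr 2
  ring

/-! ### The risk for a fixed hashed matrix -/
theorem integral_mul_noise {n : ℕ} {σ : ℝ} {Ω : Type*} [MeasurableSpace Ω] {P : Measure Ω}
    [IsProbabilityMeasure P] {ε : Fin n → Ω → ℝ} (hε : ∀ i, MemLp (ε i) 2 P)
    (hε_mean : ∀ i, ∫ ω, ε i ω ∂P = 0) (hε_var : ∀ i, ∫ ω, ε i ω ^ 2 ∂P = σ ^ 2)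
    (hε_cov : ∀ i j, i ≠ j → covariance (ε i) (ε j) P = 0) (i j : Fin n) :
    ∫ ω, ε i ω * ε j ω ∂P = if i = j then σ ^ 2 else 0 := by
  split_ifs with h
  · subst h
    simp_rw [← sq]
    exact hε_var i
  · have h1 := covariance_eq_sub (hε i) (hε j)
    rw [hε_cov i j h, hε_mean, zero_mul, sub_zero] at h1
    exact h1.symm

/-- A linear functional of white noise with coefficients `w` has variance `σ² ‖w‖²`. -/
theorem integral_sq_sum_mul_noise {n : ℕ} {σ : ℝ} {Ω : Type*} [MeasurableSpace Ω] {P : Measure Ω}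
    [IsProbabilityMeasure P] {ε : Fin n → Ω → ℝ} (hε : ∀ i, MemLp (ε i) 2 P)
    (hε_mean : ∀ i, ∫ ω, ε i ω ∂P = 0) (hε_var : ∀ i, ∫ ω, ε i ω ^ 2 ∂P = σ ^ 2)
    (hε_cov : ∀ i j, i ≠ j → covariance (ε i) (ε j) P = 0) (w : Fin n → ℝ) :
    Integrable (fun ω => (∑ i, w i * ε i ω) ^ 2) P ∧
      ∫ ω, (∑ i, w i * ε i ω) ^ 2 ∂P = σ ^ 2 * sqNorm w := by
  have e1 : ∀ ω, (∑ i, w i * ε i ω) ^ 2 = ∑ i, ∑ j, w i * w j * (ε i ω * ε j ω) := fun ω => by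
    rw [sq, Finset.sum_mul_sum]
    exact Finset.sum_congr rfl fun i _ => Finset.sum_congr rfl fun j _ => by ring
  have hI : ∀ i j, Integrable (fun ω => w i * w j * (ε i ω * ε j ω)) P := fun i j =>
    ((hε i).integrable_mul (hε j)).const_mul _
  have hI' : ∀ i, Integrable (fun ω => ∑ j, w i * w j * (ε i ω * ε j ω)) P := fun i =>
    integrable_finsetSum _ fun j _ => hI i j
  simp_rw [e1]
  refine ⟨integrable_finsetSum _ fun i _ => hI' i, ?_⟩
  rw [integral_finsetSum _ fun i _ => hI' i]
  simp_rw [fun i => integral_finsetSum Finset.univ fun j _ => hI i j, integral_const_mul,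
    integral_mul_noise hε hε_mean hε_var hε_cov]
  simp only [mul_ite, mul_zero, Finset.sum_ite_eq, Finset.mem_univ, if_true]
  rw [sqNorm, Finset.mul_sum]
  exact Finset.sum_congr rfl fun i _ => by ring

theorem integral_mean_noise_sq {n : ℕ} (hn : 1 ≤ n) {σ : ℝ} {Ω : Type*} [MeasurableSpace Ω]
    {P : Measure Ω} [IsProbabilityMeasure P] {ε : Fin n → Ω → ℝ} (hε : ∀ i, MemLp (ε i) 2 P)
    (hε_mean : ∀ i, ∫ ω, ε i ω ∂P = 0) (hε_var : ∀ i, ∫ ω, ε i ω ^ 2 ∂P = σ ^ 2)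
    (hε_cov : ∀ i j, i ≠ j → covariance (ε i) (ε j) P = 0) :
    Integrable (fun ω => n * mean (fun i => ε i ω) ^ 2) P ∧
      ∫ ω, n * mean (fun i => ε i ω) ^ 2 ∂P = σ ^ 2 := by
  have hn0 : (n : ℝ) ≠ 0 := by positivity
  have h := integral_sq_sum_mul_noise hε hε_mean hε_var hε_cov fun _ => 1 / (n : ℝ)
  have e1 : ∀ ω, mean (fun i => ε i ω) = ∑ i, 1 / (n : ℝ) * ε i ω := fun ω => by
    rw [mean, ← Finset.mul_sum]; ring
  simp_rw [e1]
  refine ⟨h.1.const_mul _, ?_⟩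
  rw [integral_const_mul, h.2, sqNorm]
  simp
  field_simp

/-- The noise that the columns of the centred fit can pick up. -/
theorem integral_norm_adjoint_noise_sq_le {n L : ℕ} (hn : 1 ≤ n) {S : Matrix (Fin n) (Fin L) ℝ}
    (hS : ∀ i l, S i l ^ 2 ≤ 1) {r : ℝ} (hr : 0 ≤ r) {σ : ℝ} {Ω : Type*} [MeasurableSpace Ω]
    {P : Measure Ω} [IsProbabilityMeasure P] {ε : Fin n → Ω → ℝ} (hε : ∀ i, MemLp (ε i) 2 P)
    (hε_mean : ∀ i, ∫ ω, ε i ω ∂P = 0) (hε_var : ∀ i, ∫ ω, ε i ω ^ 2 ∂P = σ ^ 2)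
    (hε_cov : ∀ i j, i ≠ j → covariance (ε i) (ε j) P = 0) :
    ∫ ω, ‖(fitOp S r).adjoint (WithLp.toLp 2 fun i => ε i ω)‖ ^ 2 ∂P ≤
      σ ^ 2 * (n * L * r) := by
  set w : Fin L → Fin n → ℝ := fun l =>
    (fitOp S r (EuclideanSpace.single l 1)).ofLp with hw
  have e1 : ∀ ω, ‖(fitOp S r).adjoint (WithLp.toLp 2 fun i => ε i ω)‖ ^ 2 =
      ∑ l, (∑ i, w l i * ε i ω) ^ 2 := fun ω => by
    rw [EuclideanSpace.real_norm_sq_eq]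
    refine Finset.sum_congr rfl fun l _ => ?_
    have h1 : (fitOp S r).adjoint (WithLp.toLp 2 fun i => ε i ω) l =
        ⟪EuclideanSpace.single l (1 : ℝ), (fitOp S r).adjoint (WithLp.toLp 2 fun i => ε i ω)⟫ := by
      simp [EuclideanSpace.inner_single_left]
    rw [h1, ContinuousLinearMap.adjoint_inner_right, PiLp.inner_apply]
    congr 1
    refine Finset.sum_congr rfl fun i _ => ?_
    simp [hw, mul_comm]
  have hwl : ∀ l, sqNorm (w l) ≤ n * r := fun l => by
    have h1 : w l = √r • center (fun i => S i l) := by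
      simp only [hw, fitOp_apply, PiLp.ofLp_single, Matrix.mulVec_smul,
        Matrix.mulVec_single_one]
      rw [center_smul]
      rfl
    have h2 : sqNorm (√r • center fun i => S i l) = r * sqNorm (center fun i => S i l) := by
      simp only [sqNorm, Pi.smul_apply, smul_eq_mul, mul_pow, Real.sq_sqrt hr, Finset.mul_sum]
    have h3 : sqNorm (center fun i => S i l) ≤ n := by
      refine (sqNorm_center_le hn _).trans ?_
      calc sqNorm (fun i => S i l) ≤ ∑ _i : Fin n, (1 : ℝ) :=
            Finset.sum_le_sum fun i _ => hS i l
        _ = n := by simp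
    rw [h1, h2, mul_comm]
    exact mul_le_mul_of_nonneg_right h3 hr
  simp_rw [e1]
  have hq := fun l => integral_sq_sum_mul_noise hε hε_mean hε_var hε_cov (w l)
  rw [integral_finsetSum _ fun l _ => (hq l).1]
  calc _ = ∑ l, σ ^ 2 * sqNorm (w l) := Finset.sum_congr rfl fun l _ => (hq l).2
    _ ≤ ∑ _l : Fin L, σ ^ 2 * (n * r) :=
        Finset.sum_le_sum fun l _ => mul_le_mul_of_nonneg_left (hwl l) (sq_nonneg _)
    _ = _ := by simp; ring

/-- The risk of the constrained ridge fit for a fixed hashed matrix `S`, compared with an arbitrary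
coefficient vector `β`, in units of the radius `√r`. The function `h` expresses the loss through the
noise vector alone, whichever minimiser is chosen. -/
theorem exists_risk {n L : ℕ} (hn : 1 ≤ n) {S : Matrix (Fin n) (Fin L) ℝ}
    (hS : ∀ i l, S i l ^ 2 ≤ 1) {r : ℝ} (hr : 0 ≤ r) (αs : ℝ) (f γ : Fin n → ℝ) (hγ : mean γ = 0)
    {σ : ℝ} {Ω : Type*} [MeasurableSpace Ω]
    {P : Measure Ω} [IsProbabilityMeasure P] {ε : Fin n → Ω → ℝ} (hε : ∀ i, MemLp (ε i) 2 P)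
    (hε_mean : ∀ i, ∫ ω, ε i ω ∂P = 0) (hε_var : ∀ i, ∫ ω, ε i ω ^ 2 ∂P = σ ^ 2)
    (hε_cov : ∀ i j, i ≠ j → covariance (ε i) (ε j) P = 0) :
    ∃ h : (Fin n → ℝ) → ℝ, Measurable h ∧ Integrable (fun ω => h fun i => ε i ω) P ∧
      (∀ e a b, IsConstrainedRidge (fun i => αs + f i + γ i + e i) S r a b →
        fitLoss αs f S a b = h e) ∧
      (r = 0 → center f = 0 → ∫ ω, h (fun i => ε i ω) ∂P = σ ^ 2) ∧
      ∀ N, 0 < N → σ ^ 2 * (n * L * r) ≤ N ^ 2 → ∀ β : Fin L → ℝ,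
        ∫ ω, h (fun i => ε i ω) ∂P ≤ sqNorm γ + 7 / 5 * sqNorm (S *ᵥ (√r • β) - f) +
          N * (1 + 4 / 5 * sqNorm β) +
          1 / 2 * max (√(sqNorm β) - 1) 0 * sqNorm (center f + γ) + σ ^ 2 := by
  set A := fitOp S r with hA
  obtain ⟨B, hBc, hB⟩ := exists_continuous_minimiser A
  set f' : EuclideanSpace ℝ (Fin n) := WithLp.toLp 2 (center f) with hf'
  set γ' : EuclideanSpace ℝ (Fin n) := WithLp.toLp 2 γ with hγ'
  have hgc : Continuous fun e : Fin n → ℝ => ‖A (B (f' + γ' + WithLp.toLp 2 e)) - f'‖ ^ 2 := by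
    fun_prop
  have hmc : Continuous fun e : Fin n → ℝ => (n : ℝ) * mean e ^ 2 := by
    unfold mean; fun_prop
  set ε' : Ω → EuclideanSpace ℝ (Fin n) := fun ω => WithLp.toLp 2 fun i => ε i ω with hε'
  have hε'L : MemLp ε' 2 P := memLp_piLp_iff.2 hε
  have hε'0 : ∫ ω, ε' ω ∂P = 0 := by
    ext i
    rw [eval_integral_piLp fun i => (hε i).integrable one_le_two]
    exact hε_mean i
  have hbm : AEStronglyMeasurable (fun ω => B (f' + γ' + ε' ω)) P :=
    hBc.comp_aestronglyMeasurable (hε'L.1.const_add _)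
  have hbL : MemLp (fun ω => B (f' + γ' + ε' ω)) 2 P :=
    (memLp_top_of_bound hbm 1 (ae_of_all _ fun ω => (hB _).1)).mono_exponent le_top
  have hgI : Integrable (fun ω => ‖A (B (f' + γ' + ε' ω)) - f'‖ ^ 2) P :=
    integrable_normSq ((A.comp_memLp' hbL).sub (memLp_const f'))
  obtain ⟨hmI, hm⟩ := integral_mean_noise_sq hn hε hε_mean hε_var hε_cov
  refine ⟨fun e => ‖A (B (f' + γ' + WithLp.toLp 2 e)) - f'‖ ^ 2 + n * mean e ^ 2,
    (hgc.add hmc).measurable, hgI.add hmI, fun e a b h => fitLoss_eq hn S hr αs f γ hγ hB h, ?_, ?_⟩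
  · intro hr0 hf0
    have hA0 : ∀ u, A u = 0 := fun u => by
      simp [hA, fitOp_apply, hr0, center_const hn (0 : ℝ),
        show (0 : Fin n → ℝ) = fun _ => 0 from rfl]
    simp only [hA0, hf', hf0]
    simpa using hm
  · intro N hN hNσ β
    rw [integral_add hgI hmI, hm]
    have h1 := integral_sq_dist_constrained_le A hε'L hε'0 hbm (fun ω => (hB _).1) f' γ'
      (fun ω u hu => (hB _).2 u hu) hN
      ((integral_norm_adjoint_noise_sq_le hn hS hr hε hε_mean hε_var hε_cov).trans hNσ)
      (WithLp.toLp 2 β)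
    have e1 : ‖A (WithLp.toLp 2 β) - f'‖ ^ 2 ≤ sqNorm (S *ᵥ (√r • β) - f) := by
      rw [hA, fitOp_apply, hf', ← WithLp.toLp_sub, norm_toLp_sq, ← center_sub]
      exact sqNorm_center_le hn _
    have e2 : ‖f' + γ'‖ ^ 2 = sqNorm (center f + γ) := by
      rw [hf', hγ', ← WithLp.toLp_add, norm_toLp_sq]
    have e3 : ‖(WithLp.toLp 2 β : EuclideanSpace ℝ (Fin L))‖ = √(sqNorm β) := by
      rw [← norm_toLp_sq, Real.sqrt_sq (norm_nonneg _)]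
    rw [hγ', norm_toLp_sq, ← hγ', e2, e3, Real.sq_sqrt (sqNorm_nonneg β)] at h1
    linarith

/-! ### Averaging over the hashing -/

/-- A seed is one independent column seed per column. -/
def seedEquiv (p L : ℕ) : HashSeed p L ≃ (Fin L → ColumnSeed p) where
  toFun s l := (s.perm l, fun k => s.sign k l)
  invFun c := ⟨fun l => (c l).1, fun k l => (c l).2 k⟩

/-- Conditioning on the seed, by independence. -/
theorem integral_seed_noise {n p L : ℕ} {Ω : Type*} [MeasurableSpace Ω] {P : Measure Ω}
    [IsProbabilityMeasure P] {ε : Fin n → Ω → ℝ} {seed : Ω → HashSeed p L}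
    (hseed : HasLaw seed (hashLaw p L) P) (hindep : IndepFun seed (fun ω i => ε i ω) P)
    {h : HashSeed p L → (Fin n → ℝ) → ℝ} (hm : ∀ s, Measurable (h s))
    (hI : ∀ s, Integrable (fun ω => h s fun i => ε i ω) P) :
    Integrable (fun ω => h (seed ω) fun i => ε i ω) P ∧
      ∫ ω, h (seed ω) (fun i => ε i ω) ∂P =
        𝔼 c, ∫ ω, h ((seedEquiv p L).symm c) (fun i => ε i ω) ∂P := by
  classical
  let _ : Fintype (HashSeed p L) := Fintype.ofEquiv _ (seedEquiv p L).symm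
  set g : HashSeed p L → HashSeed p L → ℝ := fun s t => if t = s then 1 else 0 with hg
  have hgm : ∀ s, Measurable (g s) := fun s => measurable_of_countable _
  have hgI : ∀ s, Integrable (fun ω => g s (seed ω)) P := fun s => by
    refine Integrable.of_bound
      ((hgm s).comp_aemeasurable hseed.aemeasurable).aestronglyMeasurable 1
      (ae_of_all _ fun ω => ?_)
    simp only [hg]; split_ifs <;> simp
  have hgint : ∀ s, ∫ ω, g s (seed ω) ∂P = 1 / Fintype.card (Fin L → ColumnSeed p) := fun s => by
    have e1 : g s = ({s} : Set (HashSeed p L)).indicator 1 := by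
      ext t; simp [hg, Set.indicator_apply]
    rw [← integral_map hseed.aemeasurable (hgm s).aestronglyMeasurable, hseed.map_eq, e1,
      integral_indicator_one (measurableSet_singleton s), measureReal_def, hashLaw,
      uniformOn_univ, Measure.count_singleton, Fintype.card_congr (seedEquiv p L)]
    simp
  have hterm : ∀ s, Integrable (fun ω => g s (seed ω) * h s fun i => ε i ω) P ∧
      ∫ ω, g s (seed ω) * h s (fun i => ε i ω) ∂P =
        1 / Fintype.card (Fin L → ColumnSeed p) * ∫ ω, h s (fun i => ε i ω) ∂P := fun s => by
    have hind : IndepFun (fun ω => g s (seed ω)) (fun ω => h s fun i => ε i ω) P :=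
      hindep.comp (hgm s) (hm s)
    refine ⟨hind.integrable_mul (hgI s) (hI s), ?_⟩
    rw [hind.integral_fun_mul_eq_mul_integral (hgI s).1 (hI s).1, hgint]
  have hsum : ∀ ω, h (seed ω) (fun i => ε i ω) =
      ∑ s, g s (seed ω) * h s (fun i => ε i ω) := fun ω => by
    simp [hg]
  simp_rw [hsum]
  refine ⟨integrable_finsetSum _ fun s _ => (hterm s).1, ?_⟩
  rw [integral_finsetSum _ fun s _ => (hterm s).1, Finset.sum_congr rfl fun s _ => (hterm s).2,
    ← Finset.mul_sum, Fintype.expect_eq_sum_div_card, one_div_mul_eq_div]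
  congr 1
  exact Fintype.sum_equiv (seedEquiv p L) _ _ fun s => by simp

theorem hashMatrix_seedEquiv_symm {n p L : ℕ} (X : Matrix (Fin n) (Fin p) ℝ)
    (c : Fin L → ColumnSeed p) {i : Fin n} (hz : (rowSupport X i).Nonempty) (l : Fin L) :
    hashMatrix X ((seedEquiv p L).symm c) i l = hashEntry (X i) (rowSupport X i) hz (c l) := by
  simp [hashMatrix, hz, seedEquiv, hashEntry]

theorem hashMatrix_sq_le {n p L : ℕ} {X : Matrix (Fin n) (Fin p) ℝ} (hX : ∀ i k, |X i k| ≤ 1)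
    (s : HashSeed p L) (i : Fin n) (l : Fin L) : hashMatrix X s i l ^ 2 ≤ 1 := by
  by_cases hz : (rowSupport X i).Nonempty
  · rw [← (seedEquiv p L).symm_apply_apply s, hashMatrix_seedEquiv_symm X _ hz]
    exact hashEntry_sq_le (hX i) hz _
  · simp [hashMatrix, hz]

theorem interactionSignal_eq {n p : ℕ} (X : Matrix (Fin n) (Fin p) ℝ) (θ : Fin p → ℝ)
    (Θ : Matrix (Fin p) (Fin p) ℝ) (i : Fin n) :
    interactionSignal X θ Θ i = ∑ k ∈ rowSupport X i,
      X i k * (θ k + ∑ k', (if k' ∈ rowSupport X i then 0 else 1) * Θ k k') := by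
  have hmem : ∀ k, k ∈ rowSupport X i ↔ X i k ≠ 0 := fun k => by simp [rowSupport]
  rw [interactionSignal, ← Finset.sum_add_distrib]
  symm
  refine Finset.sum_subset_zero_on_sdiff (Finset.subset_univ _) (fun k hk => ?_) fun k hk => ?_
  · have : X i k = 0 := by simpa [hmem] using hk
    simp [this]
  · rw [mul_add, Finset.mul_sum]
    congr 1
    refine Finset.sum_congr rfl fun k' _ => ?_
    by_cases h : X i k' = 0 <;> simp [hmem, h]

theorem interactionSignal_eq_zero {n p q : ℕ} (X : Matrix (Fin n) (Fin p) ℝ) {θ : Fin p → ℝ}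
    {Θ : Matrix (Fin p) (Fin p) ℝ} (hq : 1 ≤ q) (hqp : q ≤ p) (h : coefSize q θ Θ = 0) :
    interactionSignal X θ Θ = 0 := by
  have hA := one_le_hashDim hq hqp
  have hI := interSize_nonneg Θ
  rw [coefSize_eq, add_eq_zero_iff_of_nonneg (Real.sqrt_nonneg _) (Real.sqrt_nonneg _),
    Real.sqrt_eq_zero (sqNorm_nonneg θ), Real.sqrt_eq_zero (by positivity)] at h
  have hθ : ∀ k, θ k = 0 := fun k => by
    have := (Finset.sum_eq_zero_iff_of_nonneg fun k _ => sq_nonneg (θ k)).1 h.1 k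
      (Finset.mem_univ k)
    simpa using this
  have hΘ : ∀ k k', Θ k k' = 0 := fun k k' => by
    have h0 : interSize Θ = 0 := by
      rcases mul_eq_zero.1 h.2 with h' | h'
      · linarith
      · exact h'
    have h1 := (Finset.sum_eq_zero_iff_of_nonneg fun k _ => Finset.sum_nonneg fun k₁ _ =>
      Finset.sum_nonneg fun k₂ _ => abs_nonneg (Θ k k₁ * Θ k k₂)).1 h0 k (Finset.mem_univ k)
    have h2 := (Finset.sum_eq_zero_iff_of_nonneg fun k₁ _ =>
      Finset.sum_nonneg fun k₂ _ => abs_nonneg (Θ k k₁ * Θ k k₂)).1 h1 k' (Finset.mem_univ k')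
    have h3 := (Finset.sum_eq_zero_iff_of_nonneg fun k₂ _ =>
      abs_nonneg (Θ k k' * Θ k k₂)).1 h2 k' (Finset.mem_univ k')
    simpa using h3
  ext i
  simp [interactionSignal, hθ, hΘ]

theorem ridgeRadius_eq (p q L : ℕ) (η ℓ : ℝ) :
    ridgeRadius p q L η ℓ = 2 * (1 + η) * (hashDim p q * ℓ ^ 2) / L := by
  rw [ridgeRadius, hashDim]; ring

/-- The risk averaged over the hashing, before normalisation by the sample size. -/
theorem expect_risk_le {n p L q : ℕ} (hL : 1 ≤ L) (hq : 1 ≤ q) (hqp : q ≤ p)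
    {X : Matrix (Fin n) (Fin p) ℝ} (hX : ∀ i k, |X i k| ≤ 1)
    (hrow : ∀ i, (rowSupport X i).card = q) (θ : Fin p → ℝ) (Θ : Matrix (Fin p) (Fin p) ℝ)
    (hℓ : 0 < coefSize q θ Θ) {η N g d v : ℝ} (hη : 0 < η) (hN : 0 ≤ N) (hd : 0 ≤ d)
    {R : (Fin L → ColumnSeed p) → ℝ}
    (hR : ∀ (c : Fin L → ColumnSeed p) (β : Fin L → ℝ),
      R c ≤ g + 7 / 5 * sqNorm (hashMatrix X ((seedEquiv p L).symm c) *ᵥ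
          (√(ridgeRadius p q L η (coefSize q θ Θ)) • β) - interactionSignal X θ Θ) +
        N * (1 + 4 / 5 * sqNorm β) + 1 / 2 * max (√(sqNorm β) - 1) 0 * d + v) :
    𝔼 c, R c ≤ g + 7 / 5 * (n * (hashDim p q * coefSize q θ Θ ^ 2 / L)) + 7 / 5 * N +
      Real.exp (-(L * η ^ 2 / (4 * hashDim p q ^ 2 * (3 + 2 * η)))) * d + v := by
  set A := hashDim p q with hA
  set ℓ := coefSize q θ Θ with hℓdef
  set r := ridgeRadius p q L η ℓ with hr
  have hA1 : 1 ≤ A := one_le_hashDim hq hqp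
  have hL0 : (0 : ℝ) < L := by exact_mod_cast hL
  have hreq : r = 2 * (1 + η) * (A * ℓ ^ 2) / L := ridgeRadius_eq _ _ _ _ _
  have hr0 : 0 < r := by rw [hreq]; positivity
  have hsr : √r ≠ 0 := (Real.sqrt_pos.2 hr0).ne'
  set b : (Fin L → ColumnSeed p) → Fin L → ℝ := fun c l => oracleColumn q θ Θ (c l) / L with hb
  set Z : (Fin L → ColumnSeed p) → ℝ := fun c =>
    (∑ l, oracleColumn q θ Θ (c l) ^ 2) / (2 * L * (1 + η) * (A * ℓ ^ 2)) with hZ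
  have hz : ∀ i, (rowSupport X i).Nonempty := fun i =>
    Finset.card_pos.1 (by rw [hrow]; exact hq)
  have hZeq : ∀ c, sqNorm ((√r)⁻¹ • b c) = Z c := fun c => by
    simp only [sqNorm, Pi.smul_apply, smul_eq_mul, mul_pow, inv_pow, Real.sq_sqrt hr0.le, hb,
      div_pow, hZ]
    rw [← Finset.mul_sum, ← Finset.sum_div, hreq]
    field_simp
  have hE : 𝔼 c, sqNorm (hashMatrix X ((seedEquiv p L).symm c) *ᵥ b c -
      interactionSignal X θ Θ) ≤ n * (A * ℓ ^ 2 / L) := by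
    simp only [sqNorm]
    rw [Finset.expect_sum_comm]
    calc _ ≤ ∑ _i : Fin n, A * ℓ ^ 2 / L := by
          refine Finset.sum_le_sum fun i _ => ?_
          simp only [Pi.sub_apply, Matrix.mulVec, dotProduct, hashMatrix_seedEquiv_symm X _ (hz i),
            interactionSignal_eq, hb]
          exact expect_oracle_error_sq_le hL (hrow i) (hz i) (hX i) θ Θ
      _ = _ := by simp
  have hZ2 : 𝔼 c, Z c ≤ 1 / 2 := by
    rw [hZ, ← Finset.expect_div, div_le_iff₀ (by positivity)]
    refine (expect_sum_oracleColumn_sq_le hq hqp θ Θ).trans ?_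
    nlinarith [show 0 < L * (A * ℓ ^ 2) * η by positivity]
  have hM := expect_half_max_oracle_norm_le hq hqp hL θ Θ hℓ hη
  calc 𝔼 c, R c ≤ 𝔼 c, (g + 7 / 5 * sqNorm (hashMatrix X ((seedEquiv p L).symm c) *ᵥ b c -
          interactionSignal X θ Θ) + N * (1 + 4 / 5 * Z c) +
          1 / 2 * max (√(Z c) - 1) 0 * d + v) := by
        refine Finset.expect_le_expect fun c _ => ?_
        have := hR c ((√r)⁻¹ • b c)
        rwa [smul_inv_smul₀ hsr, hZeq] at this
    _ = g + 7 / 5 * (𝔼 c, sqNorm (hashMatrix X ((seedEquiv p L).symm c) *ᵥ b c -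
          interactionSignal X θ Θ)) + N * (1 + 4 / 5 * 𝔼 c, Z c) +
          (𝔼 c, 1 / 2 * max (√(Z c) - 1) 0) * d + v := by
        simp only [Finset.expect_add_distrib, ← Finset.mul_expect, ← Finset.expect_mul,
          Fintype.expect_const]
    -- the oracle has mean squared norm at most `1 / 2` in units of the radius
    _ ≤ g + 7 / 5 * (n * (A * ℓ ^ 2 / L)) + N * (1 + 4 / 5 * (1 / 2)) +
          Real.exp (-(L * η ^ 2 / (4 * A ^ 2 * (3 + 2 * η)))) * d + v := by
        gcongr
    _ = _ := by ring

end MinWise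

theorem mainTheorem8
    {n p L q : ℕ} (hn : 1 ≤ n) (hL : 1 ≤ L) (hp : 3 ≤ p) (hq : 1 ≤ q)
    (X : Matrix (Fin n) (Fin p) ℝ) (hX : ∀ i k, |X i k| ≤ 1)
    (hrow : ∀ i, (MinWise.rowSupport X i).card = q)
    (θ : Fin p → ℝ) (Θ : Matrix (Fin p) (Fin p) ℝ) (hΘ : ∀ k, Θ k k = 0)
    (αs : ℝ) (γ : Fin n → ℝ) (hγ : ∑ i, γ i = 0)
    (σ η : ℝ) (hσ : 0 < σ) (hη : 0 < η)
    {Ω : Type*} [MeasurableSpace Ω] (P : Measure Ω) [IsProbabilityMeasure P]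
    -- the noise: centred, variance `σ²`, pairwise uncorrelated
    (ε : Fin n → Ω → ℝ) (hε : ∀ i, MemLp (ε i) 2 P)
    (hε_mean : ∀ i, ∫ ω, ε i ω ∂P = 0)
    (hε_var : ∀ i, ∫ ω, ε i ω ^ 2 ∂P = σ ^ 2)
    (hε_cov : ∀ i j, i ≠ j → covariance (ε i) (ε j) P = 0)
    -- the permutations and signs of the hashing, independent of the noise
    (seed : Ω → MinWise.HashSeed p L) (hseed : HasLaw seed (MinWise.hashLaw p L) P)
    (hindep : IndepFun seed (fun ω i => ε i ω) P)
    -- the constrained ridge estimator computed from `Y = α* 1 + f* + γ + ε` and `S`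
    (αhat : Ω → ℝ) (bhat : Ω → Fin L → ℝ)
    (hridge : ∀ᵐ ω ∂P, MinWise.IsConstrainedRidge
      (fun i => αs + MinWise.interactionSignal X θ Θ i + γ i + ε i ω)
      (MinWise.hashMatrix X (seed ω))
      (MinWise.ridgeRadius p q L η (MinWise.coefSize q θ Θ)) (αhat ω) (bhat ω)) :
    Integrable (fun ω => MinWise.fitLoss αs (MinWise.interactionSignal X θ Θ)
      (MinWise.hashMatrix X (seed ω)) (αhat ω) (bhat ω)) P ∧
    MinWise.mspe P αs (MinWise.interactionSignal X θ Θ)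
        (fun ω => MinWise.hashMatrix X (seed ω)) αhat bhat ≤
      √((2 - (q : ℝ) / p) * q) * MinWise.coefSize q θ Θ *
          ((2 * σ * √(1 + η) +
            √2 * σ * (MinWise.optDim n p q σ (MinWise.coefSize q θ Θ) / L)) / √(n : ℝ)) +
        MinWise.rhoTwo p q L η *
          (MinWise.sqNorm (fun i => MinWise.interactionSignal X θ Θ i -
            MinWise.mean (MinWise.interactionSignal X θ Θ) + γ i) / n) +
        MinWise.sqNorm γ / n + σ ^ 2 / n := by
  open MinWise in
  have hqp : q ≤ p := by
    rw [← hrow ⟨0, hn⟩]; simpa using Finset.card_le_univ (rowSupport X ⟨0, hn⟩)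
  set f := interactionSignal X θ Θ with hf
  set ℓ := coefSize q θ Θ with hℓ
  set A := hashDim p q with hA
  set r := ridgeRadius p q L η ℓ with hr
  have hA1 : 1 ≤ A := one_le_hashDim hq hqp
  have hL0 : (0 : ℝ) < L := by exact_mod_cast hL
  have hn0 : (0 : ℝ) < n := by exact_mod_cast hn
  have hℓ0 : 0 ≤ ℓ := add_nonneg (Real.sqrt_nonneg _) (Real.sqrt_nonneg _)
  have hreq : r = 2 * (1 + η) * (A * ℓ ^ 2) / L := ridgeRadius_eq _ _ _ _ _
  have hr0 : 0 ≤ r := by rw [hreq]; positivity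
  have hγ' : mean γ = 0 := by simp [mean, hγ]
  have hrisk := fun s => exists_risk hn (hashMatrix_sq_le (L := L) hX s) hr0 αs f γ hγ' hε hε_mean
    hε_var hε_cov
  choose h hm hI hloss hzero hbound using hrisk
  obtain ⟨hint, havg⟩ := integral_seed_noise hseed hindep hm hI
  have hae : (fun ω => h (seed ω) fun i => ε i ω) =ᵐ[P]
      fun ω => fitLoss αs f (hashMatrix X (seed ω)) (αhat ω) (bhat ω) := by
    filter_upwards [hridge] with ω hω
    exact (hloss _ _ _ _ hω).symm
  refine ⟨hint.congr hae, ?_⟩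
  set d := sqNorm (fun i => f i - mean f + γ i) with hd
  have hd0 : 0 ≤ d := sqNorm_nonneg _
  have hρ : Real.exp (-(L * η ^ 2 / (4 * A ^ 2 * (3 + 2 * η)))) ≤ rhoTwo p q L η := by
    have e : 4 * A ^ 2 * (3 + 2 * η) =
        4 * (2 - (q : ℝ) / p) ^ 2 * (3 + 2 * η) * (q : ℝ) ^ 2 := by rw [hA, hashDim]; ring
    rw [e, rhoTwo]
    exact le_add_of_nonneg_left (Real.exp_nonneg _)
  have hρ0 : 0 ≤ rhoTwo p q L η := (Real.exp_nonneg _).trans hρ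
  rw [mspe, ← integral_congr_ae hae, havg]
  change _ ≤ √A * ℓ * ((2 * σ * √(1 + η) + √2 * σ * (√(A * n) * ℓ / σ / L)) / √(n : ℝ)) +
    rhoTwo p q L η * (d / n) + sqNorm γ / n + σ ^ 2 / n
  -- if `ℓ = 0`, signal and radius vanish, and only the error of the intercept is left
  rcases hℓ0.eq_or_lt with hℓz | hℓpos
  · have hf0 : f = 0 := interactionSignal_eq_zero X hq hqp hℓz.symm
    have hrz : r = 0 := by rw [hreq, ← hℓz]; simp
    have hcz : center f = 0 := by rw [hf0]; exact center_const hn 0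
    simp_rw [fun s => hzero s hrz hcz]
    rw [Fintype.expect_const, ← hℓz]
    have := sqNorm_nonneg γ
    simp only [mul_zero, zero_mul, zero_add]
    exact le_add_of_nonneg_left (by positivity)
  · have hrpos : 0 < r := by rw [hreq]; positivity
    set N := σ * √(n * L * r) with hN
    have hNpos : 0 < N := by positivity
    have hN2 : σ ^ 2 * (n * L * r) ≤ N ^ 2 := by
      rw [hN, mul_pow, Real.sq_sqrt (by positivity)]
    have hmain := expect_risk_le hL hq hqp hX hrow θ Θ hℓpos hη hNpos.le hd0
      fun c β => hbound ((seedEquiv p L).symm c) N hNpos hN2 β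
    have hNeq : N = √2 * (σ * √(1 + η) * (√A * ℓ * √n)) := by
      rw [hN, hreq, show n * L * (2 * (1 + η) * (A * ℓ ^ 2) / L) =
        2 * ((1 + η) * (A * (n * ℓ ^ 2))) by field_simp, Real.sqrt_mul (by norm_num),
        Real.sqrt_mul (by positivity), Real.sqrt_mul (by positivity),
        Real.sqrt_mul (by positivity), Real.sqrt_sq hℓ0]
      ring
    have hs2 : (7 : ℝ) / 5 ≤ √2 := Real.le_sqrt_of_sq_le (by norm_num)
    have hsq2 : √2 * √2 = (2 : ℝ) := Real.mul_self_sqrt (by norm_num)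
    have hsn : √(n : ℝ) * √(n : ℝ) = n := Real.mul_self_sqrt hn0.le
    have hsA : √A * √A = A := Real.mul_self_sqrt (by linarith)
    have hsn0 : 0 < √(n : ℝ) := Real.sqrt_pos.2 hn0
    rw [div_le_iff₀ hn0]
    refine hmain.trans ?_
    have e1 : (√A * ℓ * ((2 * σ * √(1 + η) + √2 * σ * (√(A * n) * ℓ / σ / L)) / √(n : ℝ)) +
        rhoTwo p q L η * (d / n) + sqNorm γ / n + σ ^ 2 / n) * n =
        √2 * (√2 * (σ * √(1 + η) * (√A * ℓ * √n))) + √2 * (n * (A * ℓ ^ 2 / L)) +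
          rhoTwo p q L η * d + sqNorm γ + σ ^ 2 := by
      rw [Real.sqrt_mul (by linarith : 0 ≤ A)]
      calc _ = (√A * ℓ * (2 * σ * √(1 + η))) * (n / √(n : ℝ)) +
            √2 * ((√A * √A) * ℓ ^ 2 / L) * n +
            rhoTwo p q L η * d + sqNorm γ + σ ^ 2 := by field_simp
        _ = _ := by
          rw [show (n : ℝ) / √n = √n by rw [div_eq_iff hsn0.ne', hsn], hsA]
          rw [← mul_assoc √2 √2, hsq2]
          ring
    rw [e1, ← hNeq]
    have t1 : 7 / 5 * N ≤ √2 * N := mul_le_mul_of_nonneg_right hs2 hNpos.le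
    have t2 : 7 / 5 * (n * (A * ℓ ^ 2 / L)) ≤ √2 * (n * (A * ℓ ^ 2 / L)) :=
      mul_le_mul_of_nonneg_right hs2 (by positivity)
    have t3 := mul_le_mul_of_nonneg_right hρ hd0
    linarith
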